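/- All graphs are finite and simple. A graph is \emph{Eulerian} if every vertex has even degree (it need not be connected). For an Eulerian graph $G=(V,E)$, a \emph{cycle odd-cover} of $G$ is a collection of cycles in the complete graph on $V$ (so their edges need not be edges of $G$) whose symmetric difference of edge sets is $E$; that is, every edge of $G$ lies in an odd number, and every non-edge in an even number, of the cycles. Let $c_2(G)$ be the minimum number of cycles in a cycle odd-cover of $G$. Let $c_{2,\mathrm{top}}(G)$ be the minimum of $c_2(H)$ over all subdivisions $H$ of $G$ (including $G$ itself), and let $c_{2,\mathrm{iso}}(G)$ be the minimum of $c_2(H)$ over all graphs $H$ obtained from $G$ by adding finitely many (possibly zero) isolated vertices. Let $\Delta(G)$ be the maximum degree of $G$, and let the linear arboricity $\mathrm{la}(G)$ be the minimum number of pairwise edge-disjoint linear forests (graphs each of whose components is a path) whose edge sets together form $E$. \textbf{Theorem.} For every Eulerian graph $G$, a cycle odd-cover exists, and the following hold: \begin{enumerate} \item $c_{2,\mathrm{top}}(G)=\dfrac{\Delta(G)}{2}$, provided that $G$ is not, up to isolated vertices, a union of two or more vertex-disjoint cycles; \item $c_{2,\mathrm{iso}}(G)\le \mathrm{la}(G)$;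 \item $c_2(G)\le \Delta(G)$. \end{enumerate} -/

import Mathlib

universe u

namespace OddCover

/-- The graph `C` on `V` consists of a single cycle (of length at least `3`) and possibly some
isolated vertices. -/
def IsCycleGraph {V : Type u} (C : SimpleGraph V) : Prop :=
  ∃ (x : V) (p : C.Walk x x), p.IsCycle ∧ ∀ e ∈ C.edgeSet, e ∈ p.edges

/-- `C 0, …, C (k - 1)` is a cycle odd-cover of `G`: these are cycles in the complete graph on `V`,
and the edges of `G` are exactly the pairs that lie in an odd number of them. -/
def IsCycleOddCover {V : Type u} (G : SimpleGraph V) {k : ℕ} (C : Fin k → SimpleGraph V) : Prop :=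
  (∀ i, IsCycleGraph (C i)) ∧
    ∀ e : Sym2 V, e ∈ G.edgeSet ↔ Odd {i : Fin k | e ∈ (C i).edgeSet}.ncard

/-- The cycle odd-cover number: the least size of a cycle odd-cover of `G`
(`⊤` if there is none). -/
noncomputable def c2 {V : Type u} (G : SimpleGraph V) : ℕ∞ :=
  sInf {n : ℕ∞ | ∃ (k : ℕ) (C : Fin k → SimpleGraph V), IsCycleOddCover G C ∧ n = (k : ℕ∞)}

/-- Subdivide the edge `ab` of `G` once: remove it and join both ends to the new vertex `none`. -/
def subdivideEdge {V : Type u} (G : SimpleGraph V) (a b : V) : SimpleGraph (Option V) :=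
  (G.deleteEdges {s(a, b)}).map Function.Embedding.some ⊔
    SimpleGraph.edge (some a) none ⊔ SimpleGraph.edge none (some b)

/-- `IsSubdivision G H`: up to isomorphism, `H` arises from `G` by finitely many (possibly zero)
successive subdivisions of edges. -/
inductive IsSubdivision : {V W : Type u} → SimpleGraph V → SimpleGraph W → Prop
  | of_iso {V W : Type u} {G : SimpleGraph V} {H : SimpleGraph W} (e : G ≃g H) :
      IsSubdivision G H
  | step {V W : Type u} {G : SimpleGraph V} {H : SimpleGraph W} {a b : V} (hab : G.Adj a b)
      (h : IsSubdivision (subdivideEdge G a b) H) : IsSubdivision G H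

/-- The minimum of `c2 H` over all subdivisions `H` of `G`. -/
noncomputable def c2Top {V : Type u} (G : SimpleGraph V) : ℕ∞ :=
  sInf {n : ℕ∞ | ∃ (W : Type u) (H : SimpleGraph W), IsSubdivision G H ∧ n = c2 H}

/-- The minimum of `c2 H` over all graphs `H` obtained from `G` by adding `m` isolated vertices,
`m` being any natural number. -/
noncomputable def c2Iso {V : Type u} (G : SimpleGraph V) : ℕ∞ :=
  ⨅ m : ℕ, c2 (G ⊕g (⊥ : SimpleGraph (Fin m)))

/-- A linear forest: every connected component is a path (possibly a single vertex). -/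
def IsLinearForest {V : Type u} (F : SimpleGraph V) : Prop :=
  ∀ c : F.ConnectedComponent, ∃ (x y : V) (p : F.Walk x y), p.IsPath ∧ c.toSubgraph = p.toSubgraph

/-- `F 0, …, F (k - 1)` are edge-disjoint linear forests that decompose the edges of `G`. -/
def IsLinearForestDecomposition {V : Type u} (G : SimpleGraph V) {k : ℕ}
    (F : Fin k → SimpleGraph V) : Prop :=
  (∀ i, IsLinearForest (F i)) ∧
    (∀ i j, i ≠ j → Disjoint (F i).edgeSet (F j).edgeSet) ∧
    G.edgeSet = ⋃ i, (F i).edgeSet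

/-- The linear arboricity of `G`: the least number of edge-disjoint linear forests that decompose
the edges of `G`. -/
noncomputable def la {V : Type u} (G : SimpleGraph V) : ℕ∞ :=
  sInf {n : ℕ∞ | ∃ (k : ℕ) (F : Fin k → SimpleGraph V),
    IsLinearForestDecomposition G F ∧ n = (k : ℕ∞)}

/-- Up to isolated vertices, `G` is a union of two or more vertex-disjoint cycles.
(The support of a graph is the set of its non-isolated vertices.) -/
def IsUnionOfTwoOrMoreDisjointCycles {V : Type u} (G : SimpleGraph V) : Prop :=
  ∃ (k : ℕ) (C : Fin k → SimpleGraph V), 2 ≤ k ∧ (∀ i, IsCycleGraph (C i)) ∧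
    (∀ i j, i ≠ j → Disjoint (C i).support (C j).support) ∧
    G.edgeSet = ⋃ i, (C i).edgeSet

end OddCover

namespace OddCover

open SimpleGraph

/-! Edge sets are vectors over `ZMod 2` and a cycle odd-cover is a way of writing the indicator of
`E` as a sum of cycles (`c2_le_of_lists`). Let `Δ = 2k`.

An Eulerian graph has a balanced orientation, with all in- and out-degrees at most `k`. Padding with
loops and applying Birkhoff's theorem repeatedly writes the arcs as `k` permutations. Their
nontrivial orbits are cycles, in `k` colours, disjoint within each colour (`exists_cycle_system`).
Disjoint cycles form the sum of at most two cycles: open each one, string the pieces into one long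
cycle, and cancel the errors by a second cycle through the cut points (`exists_at_most_two_cycles`).
This gives `c2 ≤ 2k`.

For subdivisions, `k` is a lower bound because a cycle has at most two edges at a vertex. For the
upper bound, subdivide until every cycle has many private vertices. Two cycles of one colour are
merged with the help of a cycle of another colour, by adding the same hexagon on private vertices to
two cycles (`cycleParity_hexagon`). In the end each colour has one cycle. Only `k = 1` offers no
second colour, and there `G` is a disjoint union of cycles.

For linear arboricity, colour the paths of the forests. As all degrees are even, every path end is
also an end of another path. Hence two paths of one colour can be joined through a fresh isolated
vertex, the two new edges being cancelled by altering paths of other colours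
(`IsPathSystem.exists_smaller`). When each colour has one path, all paths are closed through one
common fresh vertex; the edges there cancel, again by evenness. -/

theorem sum_map_sum_map_mk {k : ℕ} {X Y : Type*} [AddCommMonoid Y] (L : Fin k → Multiset X)
    (f : Fin k × X → Y) :
    ((∑ i, (L i).map (Prod.mk i)).map f).sum = ∑ i, ((L i).map fun l => f (i, l)).sum := by
  rw [← Multiset.coe_mapAddMonoidHom, map_sum, ← Multiset.coe_sumAddMonoidHom, map_sum]
  simp

/-! ### Paths and cycles as vectors over `ZMod 2` -/

section EdgeParity

variable {V W : Type*}

open scoped Classical in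
/-- The indicator function of the pair `ab`, modulo `2`. -/
noncomputable def pairParity (a b : V) (e : Sym2 V) : ZMod 2 := if e = s(a, b) then 1 else 0

/-- The parity with which a pair is traversed by the path through the given vertices. -/
noncomputable def pathParity : List V → Sym2 V → ZMod 2
  | [] => 0
  | [_] => 0
  | a :: b :: l => pairParity a b + pathParity (b :: l)

/-- The parity with which a pair is traversed by the closed path through the given vertices. -/
noncomputable def cycleParity : List V → Sym2 V → ZMod 2
  | [] => 0
  | a :: l => pathParity (a :: l ++ [a])

open scoped Classical in
/-- The indicator function of the edge set of `G`, modulo `2`. -/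
noncomputable def edgeParity (G : SimpleGraph V) (e : Sym2 V) : ZMod 2 :=
  if e ∈ G.edgeSet then 1 else 0

theorem add_self_zmod_two {X : Type*} (f : X → ZMod 2) : f + f = 0 := by
  funext x; exact CharTwo.add_self_eq_zero _

theorem pairParity_comm (a b : V) : pairParity a b = pairParity b a := by
  funext e; unfold pairParity; congr 1; rw [Sym2.eq_swap]

@[simp] theorem pathParity_nil : pathParity ([] : List V) = 0 := rfl

@[simp] theorem pathParity_singleton (a : V) : pathParity [a] = 0 := rfl

@[simp] theorem pathParity_cons_cons (a b : V) (l : List V) :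
    pathParity (a :: b :: l) = pairParity a b + pathParity (b :: l) := rfl

theorem pathParity_append_cons (l : List V) (a : V) (r : List V) :
    pathParity (l ++ a :: r) = pathParity (l ++ [a]) + pathParity (a :: r) := by
  induction l with
  | nil => simp
  | cons b l ih =>
    cases l with
    | nil => simp
    | cons c l => simp only [List.cons_append, pathParity_cons_cons] at ih ⊢; rw [ih, add_assoc]

theorem pathParity_append_cons_cons (l : List V) (a b : V) (r : List V) :
    pathParity (l ++ a :: b :: r) =
      pathParity (l ++ [a]) + pairParity a b + pathParity (b :: r) := by
  rw [pathParity_append_cons, pathParity_cons_cons, add_assoc]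

theorem pathParity_reverse (l : List V) : pathParity l.reverse = pathParity l := by
  induction l with
  | nil => rfl
  | cons a l ih =>
    cases l with
    | nil => rfl
    | cons b l =>
      simp only [List.reverse_cons, List.append_assoc, List.cons_append, List.nil_append] at ih ⊢
      rw [pathParity_append_cons, ih]
      simp [pairParity_comm a b, add_comm]

theorem cycleParity_append_comm (l r : List V) : cycleParity (l ++ r) = cycleParity (r ++ l) := by
  cases l with
  | nil => simp
  | cons a l =>
    cases r with
    | nil => simp
    | cons b r =>
      have h1 := pathParity_append_cons (a :: l) b (r ++ [a])
      have h2 := pathParity_append_cons (b :: r) a (l ++ [b])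
      simp only [cycleParity, List.cons_append, List.append_assoc] at h1 h2 ⊢
      rw [h1, h2, add_comm]

theorem cycleParity_cons_append_singleton (a : V) (l : List V) (b : V) :
    cycleParity (a :: (l ++ [b])) = pathParity (a :: (l ++ [b])) + pairParity b a := by
  have := pathParity_append_cons_cons (a :: l) b a []
  simpa [cycleParity] using this

theorem mem_of_pathParity_ne_zero {l : List V} {e : Sym2 V} (h : pathParity l e ≠ 0) {v : V}
    (hv : v ∈ e) : v ∈ l := by
  induction l with
  | nil => simp at h
  | cons a l ih =>
    cases l with
    | nil => simp at h
    | cons b l =>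
      by_cases he : e = s(a, b)
      · subst he; rcases Sym2.mem_iff.1 hv with rfl | rfl <;> simp
      · refine List.mem_cons_of_mem _ (ih fun h0 => h ?_)
        simp [pairParity, he, h0]

theorem mem_of_cycleParity_ne_zero {l : List V} {e : Sym2 V} (h : cycleParity l e ≠ 0) {v : V}
    (hv : v ∈ e) : v ∈ l := by
  cases l with
  | nil => simp [cycleParity] at h
  | cons a l =>
    have := mem_of_pathParity_ne_zero h hv
    simp at this ⊢; tauto

theorem pairParity_map {f : V → W} (hf : Function.Injective f) (a b : V) (e : Sym2 V) :
    pairParity (f a) (f b) (e.map f) = pairParity a b e := by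
  have : e.map f = s(f a, f b) ↔ e = s(a, b) := by
    rw [← Sym2.map_mk, (Sym2.map.injective hf).eq_iff]
  by_cases h : e = s(a, b) <;> simp [pairParity, this, h]

theorem pathParity_map {f : V → W} (hf : Function.Injective f) (l : List V) (e : Sym2 V) :
    pathParity (l.map f) (e.map f) = pathParity l e := by
  induction l with
  | nil => rfl
  | cons a l ih =>
    cases l with
    | nil => rfl
    | cons b l => simpa [pairParity_map hf] using ih

theorem cycleParity_map {f : V → W} (hf : Function.Injective f) (l : List V) (e : Sym2 V) :
    cycleParity (l.map f) (e.map f) = cycleParity l e := by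
  cases l with
  | nil => rfl
  | cons a l => simpa [cycleParity] using pathParity_map hf (a :: l ++ [a]) e

/-- A list without repetitions traverses no pair twice, so nothing cancels modulo 2 and the odd
pairs are exactly the edges of the walk. -/
theorem exists_walk_of_pathParity (G : SimpleGraph V) (a : V) (l : List V) (hl : (a :: l).Nodup)
    (hG : ∀ e, pathParity (a :: l) e ≠ 0 → e ∈ G.edgeSet) :
    ∃ (b : V) (p : G.Walk a b), p.support = a :: l ∧ b = (a :: l).getLast (by simp) ∧
      ∀ e, pathParity (a :: l) e ≠ 0 ↔ e ∈ p.edges := by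
  induction l generalizing a with
  | nil => exact ⟨a, .nil, rfl, rfl, by simp⟩
  | cons b l ih =>
    have key : ∀ e, pathParity (a :: b :: l) e ≠ 0 ↔ e = s(a, b) ∨ pathParity (b :: l) e ≠ 0 := by
      intro e
      by_cases he : e = s(a, b)
      · subst he
        have : pathParity (b :: l) s(a, b) = 0 := by
          by_contra h
          have := mem_of_pathParity_ne_zero h (Sym2.mem_mk_left a b)
          simp_all
        simp [pairParity, this]
      · simp [pairParity, he]
    obtain ⟨c, p, hp, hc, hpe⟩ := ih b hl.of_cons fun e he => hG e ((key e).2 (.inr he))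
    have hab : G.Adj a b := hG s(a, b) ((key _).2 (.inl rfl))
    refine ⟨c, .cons hab p, by simp [hp], by simp [hc], fun e => ?_⟩
    rw [key, hpe]; simp

/-- The graph whose edges are the pairs that are traversed an odd number of times by the closed path
through the given vertices. -/
noncomputable def cycleOfList (l : List V) : SimpleGraph V :=
  SimpleGraph.fromEdgeSet {e | cycleParity l e ≠ 0}

theorem not_isDiag_of_pathParity_ne_zero {l : List V} (hl : l.Nodup) {e : Sym2 V}
    (he : pathParity l e ≠ 0) : ¬ e.IsDiag := by
  induction l with
  | nil => simp at he
  | cons a l ih =>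
    cases l with
    | nil => simp at he
    | cons b l =>
      by_cases h : e = s(a, b)
      · subst h; simp at hl ⊢; tauto
      · refine ih hl.of_cons fun h0 => he ?_
        simp [pairParity, h, h0]

theorem not_isDiag_of_cycleParity_ne_zero {l : List V} (hl : l.Nodup) (hl2 : 2 ≤ l.length)
    {e : Sym2 V} (he : cycleParity l e ≠ 0) : ¬ e.IsDiag := by
  match l, hl2 with
  | a :: b :: l, _ =>
    by_cases h : e = s(a, b)
    · subst h; simp at hl ⊢; tauto
    · have : pathParity ((b :: l) ++ [a]) e ≠ 0 := by
        intro h0; apply he; simpa [cycleParity, pairParity, h] using h0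
      refine not_isDiag_of_pathParity_ne_zero ?_ this
      rw [List.nodup_append_comm]; exact hl

theorem mem_edgeSet_cycleOfList {l : List V} (hl : l.Nodup) (hl2 : 2 ≤ l.length) {e : Sym2 V} :
    e ∈ (cycleOfList l).edgeSet ↔ cycleParity l e ≠ 0 := by
  simp only [cycleOfList, edgeSet_fromEdgeSet, Set.mem_sdiff, Set.mem_ofPred_eq]
  exact ⟨fun h => h.1, fun h => ⟨h, not_isDiag_of_cycleParity_ne_zero hl hl2 h⟩⟩

theorem isCycleGraph_cycleOfList {V : Type u} {l : List V} (hl : l.Nodup) (hl3 : 3 ≤ l.length) :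
    IsCycleGraph (cycleOfList l) := by
  have hmem := fun e => mem_edgeSet_cycleOfList hl (by lia : 2 ≤ l.length) (e := e)
  match l, hl3 with
  | a :: b :: c :: t, _ =>
    set G := cycleOfList (a :: b :: c :: t) with hG
    have hnd : (b :: (c :: t ++ [a])).Nodup := by
      have : ((b :: c :: t) ++ [a]).Nodup := by rw [List.nodup_append_comm]; exact hl
      exact this
    -- The first edge does not recur on the way back to `a`. This uses the third vertex `c`: for a
    -- list of length 2 the pair would be traversed twice and cancel.
    have h0 : pathParity (b :: (c :: t ++ [a])) s(a, b) = 0 := by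
      have h1 : pathParity (c :: t ++ [a]) s(a, b) = 0 := by
        by_contra h
        have := mem_of_pathParity_ne_zero h (Sym2.mem_mk_right a b)
        simp_all
      have h2 : pairParity b c s(a, b) = 0 := by
        simp only [List.nodup_cons, List.mem_cons, not_or] at hl
        have : a ≠ c := hl.1.2.1
        have : a ≠ b := hl.1.1
        simp [pairParity]; grind
      simpa [h2] using h1
    have key : ∀ e, cycleParity (a :: b :: c :: t) e ≠ 0 ↔
        e = s(a, b) ∨ pathParity (b :: (c :: t ++ [a])) e ≠ 0 := by
      intro e
      by_cases he : e = s(a, b)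
      · subst he
        simp only [List.cons_append] at h0
        simp [cycleParity, h0, pairParity, -pathParity_cons_cons, pathParity_cons_cons a b]
      · simp [cycleParity, pairParity, he]
    obtain ⟨x, p, hp, hx, hpe⟩ := exists_walk_of_pathParity G b (c :: t ++ [a]) hnd
      (fun e he => (hmem e).2 ((key e).2 (.inr he)))
    have hxa : x = a := by simpa using hx
    subst hxa
    have hab : G.Adj x b := (hmem s(x, b)).2 ((key _).2 (.inl rfl))
    refine ⟨x, .cons hab p, ?_, ?_⟩
    · rw [Walk.cons_isCycle_iff, Walk.isPath_def, hp]
      exact ⟨hnd, fun h => (hpe _).2 h h0⟩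
    · intro e he
      rw [Walk.edges_cons, List.mem_cons, ← hpe, ← key]
      exact (hmem e).1 he

theorem zmod_two_eq_one_iff (x : ZMod 2) : x = 1 ↔ x ≠ 0 := by
  revert x; decide

/-- All upper bounds on `c2` pass through this reduction of odd-covers to a linear identity over
`ZMod 2`. -/
theorem c2_le_of_lists {V : Type u} (G : SimpleGraph V) (L : List (List V))
    (hL : ∀ l ∈ L, l.Nodup ∧ 3 ≤ l.length)
    (hsum : ∀ e, (L.map (cycleParity · e)).sum = edgeParity G e) : c2 G ≤ L.length := by
  refine sInf_le ⟨L.length, fun i => cycleOfList L[i], ⟨fun i => ?_, fun e => ?_⟩, rfl⟩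
  · obtain ⟨h1, h2⟩ := hL L[i] (by simp)
    exact isCycleGraph_cycleOfList h1 h2
  · have h1 : {i : Fin L.length | e ∈ (cycleOfList L[i]).edgeSet} =
        {i : Fin L.length | cycleParity L[i] e ≠ 0} := by
      ext i
      obtain ⟨h1, h2⟩ := hL L[i] (by simp)
      exact mem_edgeSet_cycleOfList h1 (by lia)
    have h2 : (L.map (cycleParity · e)).sum = ∑ i : Fin L.length, cycleParity L[i] e := by
      rw [← Fin.sum_univ_fun_getElem]
      rfl
    classical
    have h3 : ∑ i : Fin L.length, cycleParity L[i] e =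
        (({i : Fin L.length | cycleParity L[i] e ≠ 0}.ncard : ℕ) : ZMod 2) := by
      rw [Set.ncard_eq_toFinset_card', Finset.card_eq_sum_ones, Nat.cast_sum,
        Set.toFinset_ofPred, Finset.sum_filter]
      refine Finset.sum_congr rfl fun i _ => ?_
      split_ifs with h
      · rw [(zmod_two_eq_one_iff _).2 h]; rfl
      · simpa using h
    rw [h1, ← ZMod.natCast_eq_one_iff_odd, ← h3, ← h2, hsum, edgeParity]
    split_ifs with h <;> simp [h]

end EdgeParity

/-! ### Balanced orientations and their decomposition into permutations -/

section Orientation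

variable {V : Type*}

theorem ncard_mem_edges_eq_countP [DecidableEq V] {G : SimpleGraph V} {u v : V} {p : G.Walk u v}
    (hp : p.IsTrail) (x : V) :
    {e | e ∈ p.edges ∧ x ∈ e}.ncard = p.edges.countP fun e => x ∈ e := by
  have : {e | e ∈ p.edges ∧ x ∈ e} = ((p.edges.filter fun e => x ∈ e).toFinset : Set (Sym2 V)) := by
    ext e; simp
  rw [this, Set.ncard_coe_finset, List.toFinset_card_of_nodup (hp.edges_nodup.filter _),
    List.countP_eq_length_filter]

/-- A longest trail is closed: at the last vertex of an open trail an odd number of edges is used,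
so by evenness an unused edge is left to extend it. -/
theorem exists_closed_trail [Finite V] (G : SimpleGraph V) (hne : G ≠ ⊥)
    (heven : ∀ v, Even {e | e ∈ G.edgeSet ∧ v ∈ e}.ncard) :
    ∃ (u : V) (p : G.Walk u u), p.IsTrail ∧ p.edges ≠ [] := by
  classical
  have := Fintype.ofFinite V
  let P : ℕ → Prop := fun n => ∃ (u v : V) (p : G.Walk u v), p.IsTrail ∧ p.length = n
  have hbound : ∀ n, P n → n ≤ G.edgeFinset.card := by
    rintro n ⟨u, v, p, hp, rfl⟩
    exact hp.length_le_card_edgeFinset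
  obtain ⟨a, b, hab⟩ := ne_bot_iff_exists_adj.1 hne
  have h1 : P 1 := ⟨a, b, .cons hab .nil, by simp, rfl⟩
  set n := Nat.findGreatest P G.edgeFinset.card with hn
  have hPn : P n := Nat.findGreatest_spec (hbound 1 h1) h1
  have hn1 : 1 ≤ n := Nat.le_findGreatest (hbound 1 h1) h1
  obtain ⟨u, v, p, hp, hpn⟩ := hPn
  by_cases huv : u = v
  · subst huv
    refine ⟨u, p, hp, fun h => ?_⟩
    rw [← p.length_edges, h] at hpn
    simp at hpn; lia
  exfalso
  have hodd : ¬ Even {e | e ∈ p.edges ∧ v ∈ e}.ncard := by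
    rw [ncard_mem_edges_eq_countP hp, hp.even_countP_edges_iff v]
    simp [huv]
  obtain ⟨e, he, hve, hep⟩ : ∃ e ∈ G.edgeSet, v ∈ e ∧ e ∉ p.edges := by
    by_contra! h
    apply hodd
    convert heven v using 3
    ext e
    exact ⟨fun h' => ⟨p.edges_subset_edgeSet h'.1, h'.2⟩, fun h' => ⟨h e h'.1 h'.2, h'.2⟩⟩
  obtain ⟨w, rfl⟩ := Sym2.mem_iff_exists.1 hve
  have hvw : G.Adj v w := he
  have : P (n + 1) := by
    -- Walks grow at their start, so the trail is reversed before the unused edge is added.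
    refine ⟨w, u, .cons hvw.symm p.reverse, ?_, by simp [hpn]⟩
    rw [Walk.isTrail_cons]
    refine ⟨hp.reverse, ?_⟩
    rw [Walk.edges_reverse, List.mem_reverse, Sym2.eq_swap]
    exact hep
  have := Nat.le_findGreatest (hbound _ this) this
  lia

open scoped Classical in
-- `A x y` counts the traversals from `x` to `y`; a walk enters and leaves each vertex equally
-- often, up to its two ends.
theorem Walk.exists_orientation [Fintype V] {G : SimpleGraph V} {u v : V} (p : G.Walk u v) :
    ∃ A : V → V → ℕ, (∀ x y, A x y + A y x = p.edges.count s(x, y)) ∧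
      ∀ x, ∑ y, A x y + (if x = v then 1 else 0) = ∑ y, A y x + (if x = u then 1 else 0) := by
  induction p with
  | nil => exact ⟨fun _ _ => 0, by simp, by simp⟩
  | @cons u w v h p ih =>
    obtain ⟨A, hA, hbal⟩ := ih
    refine ⟨fun x y => A x y + if x = u ∧ y = w then 1 else 0, fun x y => ?_, fun x => ?_⟩
    · have hne := h.ne
      have := hA x y
      rw [Walk.edges_cons, List.count_cons, ← this]
      simp only [beq_iff_eq, Sym2.eq_iff]
      by_cases h1 : u = x ∧ w = y <;> by_cases h2 : u = y ∧ w = x <;> grind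
    · have := hbal x
      have e1 : ∑ y, (if x = u ∧ y = w then 1 else 0) = if x = u then 1 else 0 := by
        by_cases hx : x = u <;> simp [hx]
      have e2 : ∑ y, (if y = u ∧ x = w then 1 else 0) = if x = w then 1 else 0 := by
        by_cases hx : x = w <;> simp [hx]
      simp only [Finset.sum_add_distrib, e1, e2]
      lia

open scoped Classical in
-- Closed trails are removed one at a time, each oriented along itself; both the trail and the
-- remainder have even degrees.
theorem exists_balanced_orientation [Fintype V] (G : SimpleGraph V)
    (heven : ∀ v, Even {e | e ∈ G.edgeSet ∧ v ∈ e}.ncard) :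
    ∃ A : V → V → ℕ, (∀ x y, A x y + A y x = if G.Adj x y then 1 else 0) ∧
      ∀ x, ∑ y, A x y = ∑ y, A y x := by
  induction hn : G.edgeSet.ncard using Nat.strong_induction_on generalizing G with
  | _ n ih =>
  by_cases hne : G = ⊥
  · subst hne; exact ⟨fun _ _ => 0, by simp, by simp⟩
  obtain ⟨u, p, hp, hpe⟩ := exists_closed_trail G hne heven
  set G' := G.deleteEdges {e | e ∈ p.edges} with hG'
  have hes : G'.edgeSet = G.edgeSet \ {e | e ∈ p.edges} := by simp [hG']
  have hsub : {e | e ∈ p.edges} ⊆ G.edgeSet := fun e he => p.edges_subset_edgeSet he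
  have hlt : G'.edgeSet.ncard < n := by
    rw [← hn, hes]
    obtain ⟨e, he⟩ := List.exists_mem_of_ne_nil _ hpe
    exact Set.ncard_lt_ncard ⟨fun _ h => h.1, fun h => (h (hsub he)).2 he⟩ (Set.toFinite _)
  have heven' : ∀ v, Even {e | e ∈ G'.edgeSet ∧ v ∈ e}.ncard := by
    intro v
    have h1 : {e | e ∈ G.edgeSet ∧ v ∈ e} =
        {e | e ∈ G'.edgeSet ∧ v ∈ e} ∪ {e | e ∈ p.edges ∧ v ∈ e} := by
      ext e
      have := @hsub e
      simp only [hes, Set.mem_ofPred_eq, Set.mem_union, Set.mem_sdiff] at this ⊢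
      tauto
    have h2 : Disjoint {e | e ∈ G'.edgeSet ∧ v ∈ e} {e | e ∈ p.edges ∧ v ∈ e} := by
      rw [Set.disjoint_left]
      rintro e ⟨he, -⟩ ⟨he', -⟩
      rw [hes] at he
      exact he.2 he'
    have h3 := heven v
    rw [h1, Set.ncard_union_eq h2 (Set.toFinite _) (Set.toFinite _)] at h3
    have h4 : Even {e | e ∈ p.edges ∧ v ∈ e}.ncard := by
      rw [ncard_mem_edges_eq_countP hp, hp.even_countP_edges_iff v]
      simp
    exact (Nat.even_add.1 h3).2 h4
  obtain ⟨A, hA, hbal⟩ := ih _ hlt G' heven' rfl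
  obtain ⟨B, hB, hbal'⟩ := Walk.exists_orientation p
  refine ⟨fun x y => A x y + B x y, fun x y => ?_, fun x => ?_⟩
  · have h1 := hA x y
    have h2 := hB x y
    rw [hp.edges_nodup.count] at h2
    have h3 : G'.Adj x y ↔ G.Adj x y ∧ s(x, y) ∉ p.edges := by simp [hG', deleteEdges_adj]
    have h4 : s(x, y) ∈ p.edges → G.Adj x y := fun h => hsub h
    grind
  · have h1 := hbal x
    have h2 := hbal' x
    simp only [Finset.sum_add_distrib]
    lia

open scoped Classical in
-- The permutation comes from Birkhoff's theorem. Vertices of full out-degree receive no padding, so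
-- they are served by a genuine entry of `A`; this is what lets the bound drop by one when the
-- permutation is removed.
theorem exists_perm_le_of_balanced [Fintype V] (k : ℕ) (A : V → V → ℕ)
    (hbal : ∀ x, ∑ y, A x y = ∑ y, A y x) (hk : ∀ x, ∑ y, A x y ≤ k + 1) :
    ∃ σ : Equiv.Perm V, ∀ x, (σ x = x ∧ ∑ y, A x y < k + 1) ∨ 0 < A x (σ x) := by
  -- Loops fill every row sum up to `k + 1`; by balance they fill the column sums too.
  let N : V → V → ℕ := fun x y => A x y + if x = y then k + 1 - ∑ z, A x z else 0
  have hrow : ∀ x, ∑ y, N x y = k + 1 := by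
    intro x
    have := hk x
    simp only [N, Finset.sum_add_distrib, Finset.sum_ite_eq, Finset.mem_univ, if_true]
    lia
  have hcol : ∀ y, ∑ x, N x y = k + 1 := by
    intro y
    have := hk y
    have := hbal y
    simp only [N, Finset.sum_add_distrib, Finset.sum_ite_eq', Finset.mem_univ, if_true]
    lia
  let M : Matrix V V ℚ := fun x y => (N x y : ℚ) / (k + 1 : ℕ)
  have hk0 : ((k + 1 : ℕ) : ℚ) ≠ 0 := by positivity
  have hM : M ∈ doublyStochastic ℚ V := by
    rw [mem_doublyStochastic_iff_sum]
    refine ⟨fun x y => by positivity, fun x => ?_, fun y => ?_⟩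
    · simp only [M]
      rw [← Finset.sum_div, ← Nat.cast_sum, hrow, div_self hk0]
    · simp only [M]
      rw [← Finset.sum_div, ← Nat.cast_sum, hcol, div_self hk0]
  -- Any permutation of nonzero weight in the convex combination lies in the support of `N`.
  obtain ⟨w, hw0, hw1, hw⟩ := exists_eq_sum_perm_of_mem_doublyStochastic hM
  obtain ⟨σ, hσ⟩ : ∃ σ, w σ ≠ 0 := by
    by_contra! h
    simp [h] at hw1
  refine ⟨σ, fun x => ?_⟩
  have hpos : 0 < M x (σ x) := by
    rw [← hw, Matrix.sum_apply]
    refine Finset.sum_pos' (fun τ _ => ?_) ⟨σ, Finset.mem_univ _, ?_⟩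
    · have := hw0 τ
      simp only [Matrix.smul_apply, smul_eq_mul, PEquiv.toMatrix_apply]
      exact mul_nonneg this (by split_ifs <;> simp)
    · have := lt_of_le_of_ne (hw0 σ) (Ne.symm hσ)
      simpa [Equiv.toPEquiv_apply] using this
  have hN : 0 < N x (σ x) := by
    by_contra h
    have : N x (σ x) = 0 := by lia
    simp [M, this] at hpos
  simp only [N] at hN
  grind

open scoped Classical in
theorem exists_perms_of_balanced [Fintype V] (k : ℕ) (A : V → V → ℕ)
    (hbal : ∀ x, ∑ y, A x y = ∑ y, A y x) (hk : ∀ x, ∑ y, A x y ≤ k) (hdiag : ∀ x, A x x = 0) :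
    ∃ σ : Fin k → Equiv.Perm V,
      ∀ x y, x ≠ y → A x y = ∑ i, if σ i x = y then 1 else 0 := by
  induction k generalizing A with
  | zero =>
    refine ⟨Fin.elim0, fun x y _ => ?_⟩
    have := hk x
    simp only [nonpos_iff_eq_zero, Finset.sum_eq_zero_iff] at this
    simpa using this y
  | succ k ih =>
    obtain ⟨σ, hσ⟩ := exists_perm_le_of_balanced k A hbal hk
    -- Fixed points of `σ` are treated as padding and remove nothing from `A`.
    let B : V → V → ℕ := fun x y => if σ x = y ∧ x ≠ y then 1 else 0
    have hBA : ∀ x y, B x y ≤ A x y := by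
      intro x y
      simp only [B]
      have := hσ x
      grind
    have hrow : ∀ x, ∑ y, B x y = if σ x = x then 0 else 1 := by
      intro x
      have : ∀ y, B x y = if σ x = y then (if σ x = x then 0 else 1) else 0 := by
        intro y; simp only [B]; grind
      simp [this]
    have hcol : ∀ x, ∑ y, B y x = if σ x = x then 0 else 1 := by
      intro x
      have : ∀ y, B y x = if σ.symm x = y then (if σ x = x then 0 else 1) else 0 := by
        intro y
        have := Equiv.symm_apply_eq σ (x := x) (y := y)
        have := σ.injective.eq_iff (a := x) (b := y)
        simp only [B]; grind
      simp [this]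
    have hsum : ∀ x, ∑ y, (A x y - B x y) + ∑ y, B x y = ∑ y, A x y := by
      intro x
      rw [← Finset.sum_add_distrib]
      exact Finset.sum_congr rfl fun y _ => Nat.sub_add_cancel (hBA x y)
    have hsum' : ∀ x, ∑ y, (A y x - B y x) + ∑ y, B y x = ∑ y, A y x := by
      intro x
      rw [← Finset.sum_add_distrib]
      exact Finset.sum_congr rfl fun y _ => Nat.sub_add_cancel (hBA y x)
    obtain ⟨τ, hτ⟩ := ih (fun x y => A x y - B x y)
      (fun x => by
        have h1 := hsum x; have h2 := hsum' x; have h3 := hbal x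
        rw [hrow] at h1; rw [hcol] at h2; lia)
      (fun x => by
        have h1 := hsum x; have h2 := hk x
        rw [hrow] at h1
        have := hσ x; have := hdiag x
        grind)
      (fun x => by simp [hdiag])
    refine ⟨Fin.cons σ τ, fun x y hxy => ?_⟩
    have h1 := hτ x y hxy
    have h2 := hBA x y
    rw [Fin.sum_univ_succ]
    simp only [Fin.cons_zero, Fin.cons_succ]
    rw [← h1]
    simp only [B] at h2 ⊢
    grind

end Orientation

/-! ### Decomposition into coloured cycles -/

section System

variable {V ι : Type*}

open scoped Classical in
/-- The number of times that the lists of colour `i` in `S` visit the vertex `v`. -/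
noncomputable def occ (S : Multiset (ι × List V)) (i : ι) (v : V) : ℕ :=
  (S.map fun x => if x.1 = i then x.2.count v else 0).sum

/-- The number of closed paths in `S` that use the pair `e` an odd number of times. -/
noncomputable def edgeMult (S : Multiset (ι × List V)) (e : Sym2 V) : ℕ :=
  (S.map fun x => (cycleParity x.2 e).val).sum

theorem sum_fun_apply {X Y : Type*} (S : Multiset X) (f : X → Y → ZMod 2) (e : Y) :
    (S.map f).sum e = (S.map fun x => f x e).sum := by
  induction S using Multiset.induction_on with
  | empty => simp
  | cons a S ih => simp [ih]

/-- Multiplicities are kept in `ℕ` because an exact decomposition also says that each edge of a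
cycle is an edge of `G`; here they are reduced modulo 2. -/
theorem sum_cycleParity_eq_edgeMult (S : Multiset (ι × List V)) (e : Sym2 V) :
    (S.map fun x => cycleParity x.2).sum e = edgeMult S e := by
  rw [sum_fun_apply]
  induction S using Multiset.induction_on with
  | empty => simp [edgeMult]
  | cons a S ih => simp [edgeMult] at ih ⊢

theorem pathParity_iterate (σ : V → V) (x : V) (n : ℕ) :
    pathParity (List.iterate σ x (n + 1)) =
      ((List.iterate σ x n).map fun y => pairParity y (σ y)).sum := by
  induction n generalizing x with
  | zero => simp
  | succ n ih =>
    have := ih (σ x)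
    simp only [List.iterate, pathParity_cons_cons, List.map_cons, List.sum_cons] at this ⊢
    rw [this]

theorem iterate_append_singleton (σ : V → V) (x : V) (n : ℕ) :
    List.iterate σ x n ++ [σ^[n] x] = List.iterate σ x (n + 1) := by
  induction n generalizing x with
  | zero => rfl
  | succ n ih =>
    have := ih (σ x)
    simp only [List.iterate, List.cons_append, Function.iterate_succ, Function.comp] at this ⊢
    rw [this]

theorem cycleParity_iterate_minimalPeriod (σ : V → V) (x : V) :
    cycleParity (List.iterate σ x (Function.minimalPeriod σ x)) =
      ((List.iterate σ x (Function.minimalPeriod σ x)).map fun y => pairParity y (σ y)).sum := by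
  rw [← pathParity_iterate, ← iterate_append_singleton, Function.iterate_minimalPeriod]
  cases Function.minimalPeriod σ x <;> rfl

theorem nodup_iterate_minimalPeriod (σ : V → V) (x : V) :
    (List.iterate σ x (Function.minimalPeriod σ x)).Nodup := by
  rw [← List.range_map_iterate]
  exact Function.nodup_periodicOrbit

open scoped Classical in
-- By `hσ` distinct arcs lie over distinct pairs, so at most one term of the sum is nonzero and
-- nothing is lost modulo 2.
theorem val_cycleParity_iterate (σ : V → V) (x : V)
    (hσ : ∀ y z, σ y ≠ y → s(y, σ y) = s(z, σ z) → y = z)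
    (hfix : ∀ y ∈ List.iterate σ x (Function.minimalPeriod σ x), σ y ≠ y) (e : Sym2 V) :
    (cycleParity (List.iterate σ x (Function.minimalPeriod σ x)) e).val =
      ∑ y ∈ (List.iterate σ x (Function.minimalPeriod σ x)).toFinset,
        if e = s(y, σ y) then 1 else 0 := by
  have hnd := nodup_iterate_minimalPeriod σ x
  rw [cycleParity_iterate_minimalPeriod]
  set l := List.iterate σ x (Function.minimalPeriod σ x)
  have h1 : (l.map fun y => pairParity y (σ y)).sum e =
      ((∑ y ∈ l.toFinset, if e = s(y, σ y) then 1 else 0 : ℕ) : ZMod 2) := by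
    rw [← List.sum_toFinset _ hnd, Finset.sum_apply, Nat.cast_sum]
    refine Finset.sum_congr rfl fun y _ => ?_
    by_cases h : e = s(y, σ y) <;> simp [pairParity, h]
  have h2 : (∑ y ∈ l.toFinset, if e = s(y, σ y) then 1 else 0 : ℕ) < 2 := by
    rw [Finset.sum_boole, Nat.cast_id, Nat.lt_succ_iff, Finset.card_le_one]
    intro y hy z hz
    simp only [Finset.mem_filter, List.mem_toFinset] at hy hz
    exact hσ y z (hfix y hy.1) (hy.2.symm.trans hz.2)
  rw [h1, ZMod.val_natCast, Nat.mod_eq_of_lt h2]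

open scoped Classical in
-- Orbits are split off from the invariant set `T`. An orbit of length 1 is a fixed point, and in
-- one of length 2 both arcs would lie over the same pair, against `hσ`.
theorem exists_lists_of_perm [Finite V] (σ : Equiv.Perm V)
    (hσ : ∀ y z, σ y ≠ y → s(y, σ y) = s(z, σ z) → y = z) (T : Finset V)
    (hT : ∀ x ∈ T, σ x ∈ T ∧ σ x ≠ x) :
    ∃ L : Multiset (List V), (∀ l ∈ L, 3 ≤ l.length) ∧
      (∀ v, (L.map (List.count v)).sum = if v ∈ T then 1 else 0) ∧
      ∀ e, (L.map fun l => (cycleParity l e).val).sum =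
        ∑ x ∈ T, if e = s(x, σ x) then 1 else 0 := by
  induction hn : T.card using Nat.strong_induction_on generalizing T with
  | _ n ih =>
  rcases T.eq_empty_or_nonempty with rfl | ⟨x, hx⟩
  · exact ⟨0, by simp, by simp, by simp⟩
  set m := Function.minimalPeriod σ x with hm
  set l := List.iterate σ x m with hl
  have hper : x ∈ Function.periodicPts σ := σ.injective.mem_periodicPts x
  have hm0 : 0 < m := Function.minimalPeriod_pos_of_mem_periodicPts hper
  have hmem : ∀ y, y ∈ l ↔ ∃ n, σ^[n] x = y := by
    intro y
    rw [hl, ← List.range_map_iterate, ← Function.mem_periodicOrbit_iff hper]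
    rfl
  have hiter : ∀ n, σ^[n] x ∈ T := by
    intro n
    induction n with
    | zero => exact hx
    | succ n ih => rw [Function.iterate_succ_apply']; exact (hT _ ih).1
  have hlT : ∀ y ∈ l, y ∈ T := by
    intro y hy
    obtain ⟨n, rfl⟩ := (hmem y).1 hy
    exact hiter n
  have hσl : ∀ y, σ y ∈ l → y ∈ l := by
    intro y hy
    obtain ⟨n, hn⟩ := (hmem _).1 hy
    rw [hmem]
    -- On the orbit, the inverse of `σ` is its iterate of order `m - 1`.
    refine ⟨n + (m - 1), σ.injective ?_⟩
    rw [← hn, ← Function.iterate_succ_apply' (⇑σ), show (n + (m - 1)).succ = n + m by lia,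
      Function.iterate_add_apply, Function.iterate_minimalPeriod]
  have hlen : 3 ≤ l.length := by
    have h1 : m ≠ 1 := fun h => by
      rw [hm, Function.minimalPeriod_eq_one_iff_isFixedPt] at h
      exact (hT x hx).2 h
    have h2 : m ≠ 2 := fun h => by
      have h3 : σ^[m] x = x := Function.iterate_minimalPeriod
      rw [h] at h3
      have h4 : σ (σ x) = x := h3
      have := hσ x (σ x) (hT x hx).2 (by rw [h4, Sym2.eq_swap])
      exact (hT x hx).2 this.symm
    simp only [hl, List.length_iterate]; lia
  have hxl : x ∈ l := (hmem x).2 ⟨0, rfl⟩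
  have hsub : l.toFinset ⊆ T := fun y hy => hlT y (List.mem_toFinset.1 hy)
  obtain ⟨L, hL3, hLc, hLe⟩ := ih (T \ l.toFinset).card (by
    rw [← hn]
    refine Finset.card_lt_card ⟨Finset.sdiff_subset, fun h => ?_⟩
    have := h hx
    simp [hxl] at this) (T \ l.toFinset) (fun y hy => by
      simp only [Finset.mem_sdiff, List.mem_toFinset] at hy ⊢
      exact ⟨⟨(hT y hy.1).1, fun h => hy.2 (hσl y h)⟩, (hT y hy.1).2⟩) rfl
  refine ⟨l ::ₘ L, ?_, fun v => ?_, fun e => ?_⟩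
  · simpa [hlen] using hL3
  · rw [Multiset.map_cons, Multiset.sum_cons, hLc, (nodup_iterate_minimalPeriod σ x).count]
    have := hlT v
    simp only [Finset.mem_sdiff, List.mem_toFinset]
    grind
  · rw [Multiset.map_cons, Multiset.sum_cons, hLe,
      val_cycleParity_iterate σ x hσ (fun y hy => (hT y (hlT y hy)).2),
      add_comm, Finset.sum_sdiff hsub]

open scoped Classical in
/-- An Eulerian graph of maximum degree `2k` decomposes into `k` families of vertex-disjoint
cycles, none of which is empty. -/
theorem exists_cycle_system [Fintype V] (G : SimpleGraph V) [DecidableRel G.Adj]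
    (hG : ∀ v, Even (G.degree v)) (k : ℕ) (hk : G.maxDegree = 2 * k) :
    ∃ S : Multiset (Fin k × List V), (∀ x ∈ S, 3 ≤ x.2.length) ∧ (∀ i v, occ S i v ≤ 1) ∧
      (∀ e, edgeMult S e = (edgeParity G e).val) ∧ ∀ i, ∃ x ∈ S, x.1 = i := by
  have hdeg : ∀ v, {e | e ∈ G.edgeSet ∧ v ∈ e}.ncard = G.degree v := by
    intro v
    rw [← G.card_incidenceFinset_eq_degree v, ← Set.ncard_coe_finset, coe_incidenceFinset]
    rfl
  obtain ⟨A, hA, hbal⟩ := exists_balanced_orientation G (fun v => by rw [hdeg]; exact hG v)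
  have hrow : ∀ x, 2 * ∑ y, A x y = G.degree x := by
    intro x
    have : ∑ y, A x y + ∑ y, A y x = G.degree x := by
      rw [← Finset.sum_add_distrib, ← G.card_neighborFinset_eq_degree, neighborFinset_eq_filter,
        Finset.card_filter]
      exact Finset.sum_congr rfl fun y _ => (hA x y).trans (by congr)
    have := hbal x
    lia
  have hdiag : ∀ x, A x x = 0 := by
    intro x
    have := hA x x
    simp at this
    exact this
  obtain ⟨σ, hσ⟩ := exists_perms_of_balanced k A hbal
    (fun x => by have := hrow x; have := G.degree_le_maxDegree x; lia) hdiag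
  have hpos : ∀ i x, σ i x ≠ x → 1 ≤ A x (σ i x) := by
    intro i x hx
    rw [hσ x _ (Ne.symm hx)]
    exact Finset.single_le_sum (f := fun j => if σ j x = σ i x then 1 else 0)
      (fun _ _ => Nat.zero_le _) (Finset.mem_univ i) |> le_trans (by simp)
  have hσ2 : ∀ i y z, σ i y ≠ y → s(y, σ i y) = s(z, σ i z) → y = z := by
    intro i y z hy h
    rcases Sym2.eq_iff.1 h with h | ⟨h1, h2⟩
    · exact h.1
    -- Opposite arcs over the same pair would give `A y (σ i y) + A (σ i y) y ≥ 2`.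
    · exfalso
      have a1 := hpos i y hy
      have a2 := hpos i z (by rw [← h1, ← h2]; exact Ne.symm hy)
      rw [← h1, ← h2] at a2
      have := hA y (σ i y)
      split_ifs at this <;> lia
  have hL := fun i => exists_lists_of_perm (σ i) (hσ2 i) {x | σ i x ≠ x} (fun x hx => by
    simp at hx ⊢
    exact hx)
  choose L hL3 hLc hLe using hL
  refine ⟨∑ i, (L i).map (Prod.mk i), ?_, fun i v => ?_, fun e => ?_, fun i => ?_⟩
  · intro x hx
    obtain ⟨i, -, hx⟩ := Multiset.mem_sum.1 hx
    obtain ⟨l, hl, rfl⟩ := Multiset.mem_map.1 hx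
    exact hL3 i l hl
  · rw [occ, sum_map_sum_map_mk, Finset.sum_eq_single i]
    · have := hLc i v
      simp only [if_true]
      exact this.trans_le (by split_ifs <;> simp)
    · intro j _ hj
      simp [hj]
    · simp
  · rw [edgeMult, sum_map_sum_map_mk]
    simp only [hLe]
    induction e using Sym2.ind with
    | _ a b =>
    have := hA a b
    by_cases hab : a = b
    · subst hab
      have h0 : edgeParity G s(a, a) = 0 := by simp [edgeParity]
      rw [h0, ZMod.val_zero]
      refine Finset.sum_eq_zero fun i _ => Finset.sum_eq_zero fun x hx => ?_
      have : σ i x ≠ x := by simpa using hx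
      rw [if_neg]
      intro h
      rcases Sym2.eq_iff.1 h with h | h <;> grind
    · have h0 : (edgeParity G s(a, b)).val = A a b + A b a := by
        rw [this]; by_cases h : G.Adj a b <;> simp [edgeParity, h, ZMod.val_one]
      rw [h0, hσ a b hab, hσ b a (Ne.symm hab), ← Finset.sum_add_distrib]
      refine Finset.sum_congr rfl fun i _ => ?_
      have h1 : ∀ x ∈ ({x | σ i x ≠ x} : Finset V), (if s(a, b) = s(x, σ i x) then 1 else 0) =
          (if x = a then (if σ i a = b then 1 else 0) else 0) +
            (if x = b then (if σ i b = a then 1 else 0) else 0) := by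
        intro x hx
        simp only [Sym2.eq_iff]
        grind
      rw [Finset.sum_congr rfl h1, Finset.sum_add_distrib, Finset.sum_ite_eq', Finset.sum_ite_eq']
      simp only [Finset.mem_filter, Finset.mem_univ, true_and]
      grind
  · have hk0 : 0 < k := i.pos
    have hne : Nonempty V := by
      by_contra h
      rw [not_nonempty_iff] at h
      have := G.maxDegree_of_subsingleton
      lia
    -- A vertex of degree `2k` has out-degree `k`, so none of the `k` permutations fixes it. Hence
    -- every colour has a cycle through it.
    obtain ⟨v, hv⟩ := G.exists_maximal_degree_vertex
    have hv2 := hrow v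
    have h1 : ∑ y, A v y ≤ ∑ i, if σ i v ≠ v then 1 else 0 := by
      have : ∀ y, A v y = ∑ i, if σ i v = y ∧ v ≠ y then 1 else 0 := by
        intro y
        by_cases h : v = y
        · subst h; simp [hdiag]
        · simp [hσ v y h, h]
      simp only [this]
      rw [Finset.sum_comm]
      refine Finset.sum_le_sum fun i _ => ?_
      by_cases h : σ i v = v
      · simp only [h]
        refine le_of_eq (Finset.sum_eq_zero fun y _ => ?_) |>.trans (Nat.zero_le _)
        grind
      · have : ∀ y, (if σ i v = y ∧ v ≠ y then 1 else 0) = if σ i v = y then 1 else 0 := by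
          intro y; grind
        simp [this, h]
    have h2 : σ i v ≠ v := by
      intro h
      have h3 : (∑ j, if σ j v ≠ v then 1 else 0) < ∑ j : Fin k, 1 :=
        Finset.sum_lt_sum (fun j _ => by split_ifs <;> simp) ⟨i, Finset.mem_univ _, by simp [h]⟩
      simp only [Finset.sum_const, Finset.card_univ, Fintype.card_fin, smul_eq_mul] at h3
      lia
    have h3 := hLc i v
    have h4 : L i ≠ 0 := by
      intro h
      rw [h] at h3
      simp [h2] at h3
    obtain ⟨l, hl⟩ := Multiset.exists_mem_of_ne_zero h4
    exact ⟨(i, l), Multiset.mem_sum.2 ⟨i, Finset.mem_univ _, Multiset.mem_map_of_mem _ hl⟩, rfl⟩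

end System

/-! ### Disjoint cycles as a sum of two cycles -/

section TwoCycles

variable {V : Type*}

theorem exists_eq_cons_append_singleton {l : List V} (hl : 2 ≤ l.length) :
    ∃ (a b : V) (m : List V), l = a :: (m ++ [b]) := by
  match l, hl with
  | a :: b :: t, _ =>
    exact ⟨a, (b :: t).getLast (by simp), (b :: t).dropLast,
      by rw [List.dropLast_append_getLast]⟩

open scoped Classical in
-- Each cycle is cut at the edge between the last and first vertex of its list. The first path
-- concatenates the opened cycles; the second visits only the cut points in the same order. The
-- linking edges occur in both and cancel, and the second path restores the cut edges.
theorem exists_two_paths (L : Multiset (List V)) (hL : L ≠ 0) (h3 : ∀ l ∈ L, 3 ≤ l.length) :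
    ∃ (a b : V) (p q : List V),
      pathParity (a :: (p ++ [b])) + pathParity (a :: (q ++ [b])) = (L.map cycleParity).sum ∧
      (∀ v, (a :: (p ++ [b])).count v = (L.map (List.count v)).sum) ∧
      (∀ v, (a :: (q ++ [b])).count v ≤ (a :: (p ++ [b])).count v) ∧
      3 ≤ (a :: (p ++ [b])).length ∧ 2 * L.card ≤ (a :: (q ++ [b])).length := by
  induction L using Multiset.induction_on with
  | empty => exact absurd rfl hL
  | cons c L ih =>
    have hc3 := h3 c (Multiset.mem_cons_self _ _)
    obtain ⟨a', b', m, hc⟩ := exists_eq_cons_append_singleton (l := c) (by lia)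
    have hcyc := cycleParity_cons_append_singleton a' m b'
    have hcnt : ∀ v, [a', b'].count v ≤ c.count v := by
      intro v
      refine List.Sublist.count_le v ?_
      rw [hc]
      exact (List.sublist_append_right m [b']).cons_cons a'
    by_cases hL0 : L = 0
    · subst hL0
      refine ⟨a', b', m, [], ?_, ?_, ?_, ?_, by simp⟩
      · rw [hc, Multiset.map_cons, Multiset.sum_cons, hcyc, pairParity_comm]
        simp
      · intro v; rw [hc]; simp
      · intro v; rw [← hc]; exact hcnt v
      · rw [← hc]; exact hc3
    · obtain ⟨a, b, p, q, hpq, hp, hq, hp3, hq3⟩ :=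
        ih hL0 fun l hl => h3 l (Multiset.mem_cons_of_mem hl)
      have e1 : a' :: ((m ++ b' :: a :: p) ++ [b]) = c ++ (a :: (p ++ [b])) := by simp [hc]
      have e2 : a' :: ((b' :: a :: q) ++ [b]) = [a', b'] ++ (a :: (q ++ [b])) := by simp
      refine ⟨a', b, m ++ b' :: a :: p, b' :: a :: q, ?_, ?_, ?_, ?_, ?_⟩
      · have h1 := pathParity_append_cons_cons (a' :: m) b' a (p ++ [b])
        have h2 := pathParity_append_cons_cons [a'] b' a (q ++ [b])
        have e3 : a' :: ((m ++ b' :: a :: p) ++ [b]) = (a' :: m) ++ b' :: a :: (p ++ [b]) := by simp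
        have e4 : a' :: ((b' :: a :: q) ++ [b]) = [a'] ++ b' :: a :: (q ++ [b]) := by simp
        rw [e3, e4, h1, h2, Multiset.map_cons, Multiset.sum_cons, ← hpq, hc, hcyc,
          pairParity_comm b' a']
        have h3 := add_self_zmod_two (pairParity b' a)
        simp only [List.cons_append, List.nil_append, pathParity_cons_cons, pathParity_singleton]
        linear_combination h3
      · intro v
        rw [e1, List.count_append, hp, Multiset.map_cons, Multiset.sum_cons]
      · intro v
        rw [e1, e2, List.count_append, List.count_append]
        exact add_le_add (hcnt v) (hq v)
      · rw [e1, List.length_append]; lia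
      · rw [e2, List.length_append, Multiset.card_cons]
        simp only [List.length_cons, List.length_nil]
        simp only [List.length_cons] at hq3
        lia

open scoped Classical in
/-- A union of vertex-disjoint cycles is the symmetric difference of at most two cycles. -/
theorem exists_at_most_two_cycles (L : Multiset (List V)) (h3 : ∀ l ∈ L, 3 ≤ l.length)
    (hocc : ∀ v, (L.map (List.count v)).sum ≤ 1) :
    ∃ Q : List (List V), Q.length ≤ 2 ∧ (∀ l ∈ Q, l.Nodup ∧ 3 ≤ l.length) ∧
      (Q.map cycleParity).sum = (L.map cycleParity).sum := by
  by_cases hL0 : L = 0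
  · subst hL0; exact ⟨[], by simp⟩
  -- For one cycle the second path would be a single edge, which cannot be closed to a cycle.
  by_cases hL1 : L.card = 1
  · obtain ⟨l, rfl⟩ := Multiset.card_eq_one.1 hL1
    refine ⟨[l], by simp, ?_, by simp⟩
    simp only [List.mem_singleton, forall_eq]
    exact ⟨List.nodup_iff_count_le_one.2 fun v => by simpa using hocc v, h3 l (by simp)⟩
  obtain ⟨a, b, p, q, hpq, hp, hq, hp3, hq3⟩ := exists_two_paths L hL0 h3
  have h0 : L.card ≠ 0 := by simpa using hL0
  refine ⟨[a :: (p ++ [b]), a :: (q ++ [b])], by simp, ?_, ?_⟩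
  · simp only [List.mem_cons, List.not_mem_nil, or_false, forall_eq_or_imp, forall_eq]
    refine ⟨⟨List.nodup_iff_count_le_one.2 fun v => ?_, hp3⟩,
      ⟨List.nodup_iff_count_le_one.2 fun v => ?_, by lia⟩⟩
    · rw [hp]; exact hocc v
    · exact (hq v).trans ((hp v).trans_le (hocc v))
  · simp only [List.map_cons, List.map_nil, List.sum_cons, List.sum_nil,
      cycleParity_cons_append_singleton]
    -- Both paths have the ends `a` and `b`, so the closing edges cancel.
    have := add_self_zmod_two (pairParity b a)
    linear_combination hpq + this

theorem sum_flatMap {X Y : Type*} [AddCommMonoid Y] {ι : Type*} (L : List ι) (Q : ι → List X)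
    (f : X → Y) :
    ((L.flatMap Q).map f).sum = (L.map fun i => ((Q i).map f).sum).sum := by
  induction L with
  | nil => simp
  | cons i L ih => simp [ih]

open scoped Classical in
theorem sum_eq_sum_filter_fst {k : ℕ} {X Y : Type*} [AddCommMonoid Y]
    (S : Multiset (Fin k × X)) (f : X → Y) :
    (S.map fun x => f x.2).sum = ∑ i, (((S.filter fun x => x.1 = i).map Prod.snd).map f).sum := by
  induction S using Multiset.induction_on with
  | empty => simp
  | cons x S ih =>
    rw [Multiset.map_cons, Multiset.sum_cons, ih]
    have : ∀ i, ((((x ::ₘ S).filter fun x => x.1 = i).map Prod.snd).map f).sum =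
        (if x.1 = i then f x.2 else 0) +
          (((S.filter fun x => x.1 = i).map Prod.snd).map f).sum := by
      intro i
      by_cases h : x.1 = i <;> simp [h]
    simp only [this, Finset.sum_add_distrib]
    simp

open scoped Classical in
theorem occ_eq_sum_filter {ι V : Type*} [DecidableEq ι] (S : Multiset (ι × List V)) (i : ι) (v : V) :
    occ S i v = (((S.filter fun x => x.1 = i).map Prod.snd).map (List.count v)).sum := by
  unfold occ
  induction S using Multiset.induction_on with
  | empty => simp
  | cons x S ih =>
    rw [Multiset.map_cons, Multiset.sum_cons, ih]
    by_cases h : x.1 = i <;> simp [h]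

theorem c2_le_two_mul {V : Type u} {k : ℕ} (G : SimpleGraph V) (S : Multiset (Fin k × List V))
    (h3 : ∀ x ∈ S, 3 ≤ x.2.length) (hocc : ∀ i v, occ S i v ≤ 1)
    (hS : (S.map fun x => cycleParity x.2).sum = edgeParity G) : c2 G ≤ (2 * k : ℕ) := by
  classical
  have hQ := fun i : Fin k => exists_at_most_two_cycles ((S.filter fun x => x.1 = i).map Prod.snd)
    (fun l hl => by
      obtain ⟨x, hx, rfl⟩ := Multiset.mem_map.1 hl
      exact h3 x (Multiset.mem_filter.1 hx).1)
    (fun v => by rw [← occ_eq_sum_filter]; exact hocc i v)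
  choose Q hQ2 hQ3 hQs using hQ
  refine (c2_le_of_lists G ((List.finRange k).flatMap Q) ?_ ?_).trans ?_
  · intro l hl
    obtain ⟨i, -, hl⟩ := List.mem_flatMap.1 hl
    exact hQ3 i l hl
  · intro e
    have h1 : (((List.finRange k).flatMap Q).map cycleParity).sum = edgeParity G := by
      rw [sum_flatMap, ← hS, sum_eq_sum_filter_fst S cycleParity]
      simp only [hQs]
      rw [Fin.sum_univ_def]
    rw [← h1]
    generalize (List.finRange k).flatMap Q = L
    induction L with
    | nil => simp
    | cons a L ih => simp [ih]
  · rw [List.length_flatMap]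
    have : ((List.finRange k).map fun i => (Q i).length).sum ≤
        ((List.finRange k).map fun _ => 2).sum :=
      List.sum_le_sum fun i _ => hQ2 i
    simp only [List.map_const', List.length_finRange, List.sum_replicate, smul_eq_mul] at this
    exact_mod_cast (by lia)

end TwoCycles

/-! ### The lower bound from vertex degrees -/

section LowerBound

theorem IsCycleGraph.encard_neighborSet_le {V : Type u} {C : SimpleGraph V} (hC : IsCycleGraph C)
    (v : V) : (C.neighborSet v).encard ≤ 2 := by
  obtain ⟨x, p, hp, hpe⟩ := hC
  have hsub : C.neighborSet v ⊆ p.toSubgraph.neighborSet v := by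
    intro w hw
    have := hpe s(v, w) hw
    rw [Subgraph.mem_neighborSet, ← Subgraph.mem_edgeSet, Walk.mem_edges_toSubgraph]
    exact this
  by_cases hv : v ∈ p.support
  · refine (Set.encard_le_encard hsub).trans ?_
    have := hp.ncard_neighborSet_toSubgraph_eq_two hv
    have hfin := Set.finite_of_ncard_ne_zero (by rw [this]; simp)
    rw [← hfin.cast_ncard_eq, this]
    rfl
  · have : C.neighborSet v = ∅ := by
      rw [Set.eq_empty_iff_forall_notMem]
      intro w hw
      exact hv (p.fst_mem_support_of_mem_edges (hpe s(v, w) hw))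
    simp [this]

theorem encard_neighborSet_le_two_mul_c2 {V : Type u} (G : SimpleGraph V) (v : V) :
    (G.neighborSet v).encard ≤ 2 * c2 G := by
  by_cases hne : {n : ℕ∞ | ∃ (k : ℕ) (C : Fin k → SimpleGraph V),
      IsCycleOddCover G C ∧ n = (k : ℕ∞)}.Nonempty
  · obtain ⟨k, C, ⟨hC, hG⟩, hk⟩ := csInf_mem hne
    have hk' : c2 G = k := hk
    rw [hk']
    have hsub : G.neighborSet v ⊆ ⋃ i, (C i).neighborSet v := by
      intro w hw
      have h1 := (hG s(v, w)).1 hw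
      obtain ⟨i, hi⟩ := Set.nonempty_of_ncard_ne_zero h1.pos.ne'
      exact Set.mem_iUnion.2 ⟨i, hi⟩
    refine (Set.encard_le_encard hsub).trans ?_
    have h2 := fun i => (hC i).encard_neighborSet_le v
    have h3 : (⋃ i, (C i).neighborSet v).encard ≤ ∑ i, ((C i).neighborSet v).encard :=
      Set.encard_iUnion_le_of_fintype _
    refine h3.trans ((Finset.sum_le_sum fun i _ => h2 i).trans ?_)
    simp [mul_comm]
  -- Without any odd-cover `c2 G` is `⊤` and the bound is trivial.
  · rw [Set.not_nonempty_iff_eq_empty] at hne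
    rw [c2, hne, sInf_empty]
    simp

theorem subdivideEdge_adj_some {V : Type u} {G : SimpleGraph V} {a b x y : V} :
    (subdivideEdge G a b).Adj (some x) (some y) ↔ G.Adj x y ∧ s(x, y) ≠ s(a, b) := by
  have := @Adj.ne _ G x y
  simp [subdivideEdge, edge_adj, SimpleGraph.map_adj']
  tauto

theorem subdivideEdge_adj_none {V : Type u} {G : SimpleGraph V} {a b x : V} :
    (subdivideEdge G a b).Adj (some x) none ↔ x = a ∨ x = b := by
  simp [subdivideEdge, edge_adj, SimpleGraph.map_adj']

/-- An original vertex keeps its degree: if the edge to a neighbour is subdivided, the new vertex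
takes the place of that neighbour. -/
theorem IsSubdivision.exists_encard_neighborSet_le {V W : Type u} {G : SimpleGraph V}
    {H : SimpleGraph W} (h : IsSubdivision G H) (v : V) :
    ∃ w, (G.neighborSet v).encard ≤ (H.neighborSet w).encard := by
  induction h with
  | of_iso e =>
    refine ⟨e v, ?_⟩
    exact Set.encard_le_encard_of_injOn (f := e) (fun w hw => (e.map_adj_iff).2 hw)
      e.injective.injOn
  | @step V W G H a b hab h ih =>
    obtain ⟨w, hw⟩ := ih (some v)
    refine ⟨w, le_trans ?_ hw⟩
    classical
    refine Set.encard_le_encard_of_injOn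
      (f := fun x => if s(v, x) = s(a, b) then none else some x) (fun x hx => ?_) ?_
    · by_cases h : s(v, x) = s(a, b)
      · simp only [h, if_true, mem_neighborSet, subdivideEdge_adj_none]
        exact Sym2.mem_iff.1 (h ▸ Sym2.mem_mk_left v x)
      · simp only [h, if_false, mem_neighborSet, subdivideEdge_adj_some]
        exact ⟨hx, h⟩
    · intro x _ y _ hxy
      by_cases h1 : s(v, x) = s(a, b) <;> by_cases h2 : s(v, y) = s(a, b)
      · exact Sym2.congr_right.1 (h1.trans h2.symm)
      all_goals simp_all

end LowerBound

/-! ### Merging cycles of the same colour -/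

section Merge

variable {V ι : Type*}

/-- Forget which part of each list of vertices is held in reserve. -/
def unreserve (S : Multiset (ι × List V × List V)) : Multiset (ι × List V) :=
  S.map fun x => (x.1, x.2.1 ++ x.2.2)

open scoped Classical in
/-- The number of times that the lists in `S` visit the vertex `v`. -/
noncomputable def totalCount (S : Multiset (ι × List V × List V)) (v : V) : ℕ :=
  (S.map fun x => (x.2.1 ++ x.2.2).count v).sum

/-- `S` consists of coloured cycles such that those of the same colour are vertex-disjoint; the
second part of each cycle is its reserve, which no other cycle meets. -/
structure IsReservedSystem (S : Multiset (ι × List V × List V)) : Prop where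
  three_le : ∀ x ∈ S, 3 ≤ (x.2.1 ++ x.2.2).length
  occ_le : ∀ i v, occ (unreserve S) i v ≤ 1
  count_le : ∀ x ∈ S, ∀ r ∈ x.2.2, totalCount S r ≤ 1

open scoped Classical in
theorem occ_cons (x : ι × List V) (S : Multiset (ι × List V)) (i : ι) (v : V) :
    occ (x ::ₘ S) i v = (if x.1 = i then x.2.count v else 0) + occ S i v := by
  simp [occ]

theorem unreserve_cons (x : ι × List V × List V) (S : Multiset (ι × List V × List V)) :
    unreserve (x ::ₘ S) = (x.1, x.2.1 ++ x.2.2) ::ₘ unreserve S := by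
  simp [unreserve]

open scoped Classical in
theorem totalCount_cons (x : ι × List V × List V) (S : Multiset (ι × List V × List V)) (v : V) :
    totalCount (x ::ₘ S) v = (x.2.1 ++ x.2.2).count v + totalCount S v := by
  simp [totalCount]

theorem occ_le_totalCount (S : Multiset (ι × List V × List V)) (i : ι) (v : V) :
    occ (unreserve S) i v ≤ totalCount S v := by
  classical
  induction S using Multiset.induction_on with
  | empty => simp [occ, unreserve]
  | cons x S ih =>
    rw [unreserve_cons, occ_cons, totalCount_cons]
    simp only
    split_ifs <;> lia

theorem totalCount_pos {S : Multiset (ι × List V × List V)} {x : ι × List V × List V} (hx : x ∈ S)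
    {r : V} (hr : r ∈ x.2.2) : 0 < totalCount S r := by
  classical
  obtain ⟨R, rfl⟩ := Multiset.exists_cons_of_mem hx
  have : 0 < (x.2.1 ++ x.2.2).count r := List.count_pos_iff.2 (by simp [hr])
  rw [totalCount_cons]; lia

/-- With the hexagon `x₂ a₁ a₂ b₂ b₁ x₁`, the right-hand cycles are the sum of the first two cycles
with the hexagon, and the sum of the third with the hexagon. The hexagon is thus added twice. -/
theorem cycleParity_hexagon (α β ξ : List V) (a₁ a₂ b₁ b₂ x₁ x₂ : V) :
    cycleParity (α ++ [a₂, a₁]) + cycleParity (β ++ [b₁, b₂]) + cycleParity (ξ ++ [x₂, x₁]) =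
      cycleParity ([a₂, b₂] ++ β ++ [b₁, x₁, x₂, a₁] ++ α) +
        cycleParity ([x₂, a₁, a₂, b₂, b₁, x₁] ++ ξ) := by
  have key : ∀ (l : List V) (y z : V), cycleParity (l ++ [y, z]) =
      pathParity (z :: (l ++ [y])) + pairParity y z := by
    intro l y z
    have h1 := cycleParity_append_comm (l ++ [y]) [z]
    simp only [List.append_assoc, List.cons_append, List.nil_append] at h1
    rw [h1, cycleParity_cons_append_singleton]
  have h1 : cycleParity ([a₂, b₂] ++ β ++ [b₁, x₁, x₂, a₁] ++ α) =
      pairParity a₂ b₂ + pathParity (b₂ :: (β ++ [b₁])) + pairParity b₁ x₁ + pairParity x₁ x₂ +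
        pairParity x₂ a₁ + pathParity (a₁ :: (α ++ [a₂])) := by
    have := pathParity_append_cons_cons (b₂ :: β) b₁ x₁ (x₂ :: a₁ :: (α ++ [a₂]))
    simp only [List.cons_append] at this
    simp only [cycleParity, List.cons_append, List.nil_append, List.append_assoc,
      pathParity_cons_cons a₂ b₂, this, pathParity_cons_cons x₁ x₂, pathParity_cons_cons x₂ a₁]
    ring
  have h2 : cycleParity ([x₂, a₁, a₂, b₂, b₁, x₁] ++ ξ) = pairParity x₂ a₁ + pairParity a₁ a₂ +
      pairParity a₂ b₂ + pairParity b₂ b₁ + pairParity b₁ x₁ + pathParity (x₁ :: (ξ ++ [x₂])) := by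
    simp only [cycleParity, List.cons_append, List.nil_append, pathParity_cons_cons x₂ a₁,
      pathParity_cons_cons a₁ a₂, pathParity_cons_cons a₂ b₂, pathParity_cons_cons b₂ b₁,
      pathParity_cons_cons b₁ x₁]
    ring
  rw [key, key, key, h1, h2, pairParity_comm a₂ a₁, pairParity_comm b₂ b₁, pairParity_comm x₁ x₂]
  linear_combination -add_self_zmod_two (pairParity a₂ b₂) -
    add_self_zmod_two (pairParity b₁ x₁) - add_self_zmod_two (pairParity x₂ a₁)

theorem exists_append_pair {X : Type*} {l : List X} (hl : 2 ≤ l.length) :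
    ∃ (r : List X) (y z : X), l = r ++ [y, z] := by
  refine ⟨l.take (l.length - 2), l[l.length - 2], l[l.length - 1], ?_⟩
  conv_lhs => rw [← List.take_append_drop (l.length - 2) l]
  congr 1
  apply List.ext_getElem
  · simp; lia
  · intro n h1 h2
    simp at h1 h2
    rcases n with _ | _ | n
    · simp
    · simp; congr 1; lia
    · lia

/-- The six hexagon vertices are each visited only once in the whole system, so using them in both
colours creates no repetition. What is left of the reserve of the second cycle is given up. -/
theorem IsReservedSystem.merge {R : Multiset (ι × List V × List V)} {i j : ι} (hij : i ≠ j)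
    {A B X rA rB rX : List V} {a₁ a₂ b₁ b₂ x₁ x₂ : V}
    (h : IsReservedSystem ((i, A, rA ++ [a₂, a₁]) ::ₘ (i, B, rB ++ [b₁, b₂]) ::ₘ
      (j, X, rX ++ [x₂, x₁]) ::ₘ R)) :
    IsReservedSystem ((i, [a₂, b₂] ++ (B ++ rB) ++ [b₁, x₁, x₂, a₁] ++ A, rA) ::ₘ
      (j, [x₂, a₁, a₂, b₂, b₁, x₁] ++ X, rX) ::ₘ R) := by
  classical
  obtain ⟨h3, hocc, hcnt⟩ := h
  have hR := fun i v => occ_le_totalCount R i v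
  obtain ⟨δ, hδ⟩ : ∃ δ : V → V → ℕ, ∀ y v, δ y v = if y = v then 1 else 0 :=
    ⟨_, fun _ _ => rfl⟩
  have hδ1 : ∀ y, δ y y = 1 := fun y => by simp [hδ]
  have hδ0 : ∀ y v, v ≠ y → δ y v = 0 := fun y v h => by simp [hδ, Ne.symm h]
  have hc : ∀ (a b : V) (l : List V), (b :: l).count a = l.count a + δ b a := by
    intro a b l
    rw [hδ]
    by_cases h : b = a <;> simp [h]
  clear hδ
  simp only [unreserve_cons, occ_cons, totalCount_cons, Multiset.mem_cons, forall_eq_or_imp,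
    List.mem_append, List.mem_cons, List.not_mem_nil, or_false, List.count_append, hc,
    List.count_nil] at hocc hcnt
  obtain ⟨hA, hB, hX, hR'⟩ := hcnt
  refine ⟨?_, fun l v => ?_, ?_⟩
  · intro x hx
    simp only [Multiset.mem_cons] at hx
    rcases hx with rfl | rfl | hx
    · simp only [List.length_append, List.length_cons]; lia
    · simp only [List.length_append, List.length_cons]; lia
    · exact h3 x (by simp [hx])
  · have h1 := hocc l v
    have h2 := hR l v
    simp only [unreserve_cons, occ_cons, List.count_append, hc, List.count_nil]
    by_cases hv : v = a₁ ∨ v = a₂ ∨ v = b₁ ∨ v = b₂ ∨ v = x₁ ∨ v = x₂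
    -- Being reserved, `v` accounts for the entire total count: every other term vanishes.
    · have h3 : A.count v + rA.count v + B.count v + rB.count v + X.count v + rX.count v +
          (δ a₁ v + δ a₂ v + δ b₁ v + δ b₂ v + δ x₁ v + δ x₂ v) + totalCount R v ≤ 1 := by
        rcases hv with rfl | rfl | rfl | rfl | rfl | rfl
        · have := hA v (by simp); lia
        · have := hA v (by simp); lia
        · have := hB v (by simp); lia
        · have := hB v (by simp); lia
        · have := hX v (by simp); lia
        · have := hX v (by simp); lia
      by_cases hi : i = l <;> by_cases hj : j = l <;> simp only [hi, hj, if_true, if_false]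
      · exact absurd (hi.trans hj.symm) hij
      all_goals lia
    · push Not at hv
      obtain ⟨e1, e2, e3, e4, e5, e6⟩ := hv
      simp only [hδ0 _ _ e1, hδ0 _ _ e2, hδ0 _ _ e3, hδ0 _ _ e4, hδ0 _ _ e5, hδ0 _ _ e6] at h1 ⊢
      by_cases hi : i = l <;> by_cases hj : j = l <;>
        simp only [hi, hj, if_true, if_false] at h1 ⊢ <;> lia
  · intro x hx r hr
    simp only [totalCount_cons, List.count_append, hc, List.count_nil]
    simp only [Multiset.mem_cons] at hx
    rcases hx with rfl | rfl | hx
    · have h1 := hA r (.inl hr)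
      have h2 := List.count_pos_iff.2 hr
      lia
    · have h1 := hX r (.inl hr)
      have h2 := List.count_pos_iff.2 hr
      lia
    · have h1 := hR' x hx r hr
      have h2 := totalCount_pos hx hr
      lia

theorem exists_cons_cons_of_two_le_card_filter {X : Type*} {S : Multiset X} {p : X → Prop}
    [DecidablePred p] (h : 2 ≤ (S.filter p).card) :
    ∃ (x y : X) (R : Multiset X), S = x ::ₘ y ::ₘ R ∧ p x ∧ p y := by
  obtain ⟨x, hx⟩ := Multiset.exists_mem_of_ne_zero (s := S.filter p) (by rintro h0; simp [h0] at h)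
  obtain ⟨hx, hpx⟩ := Multiset.mem_filter.1 hx
  obtain ⟨R, rfl⟩ := Multiset.exists_cons_of_mem hx
  rw [Multiset.filter_cons_of_pos _ hpx, Multiset.card_cons] at h
  obtain ⟨y, hy⟩ := Multiset.exists_mem_of_ne_zero (s := R.filter p) (by rintro h0; simp [h0] at h)
  obtain ⟨hy, hpy⟩ := Multiset.mem_filter.1 hy
  obtain ⟨R, rfl⟩ := Multiset.exists_cons_of_mem hy
  exact ⟨x, y, R, rfl, hpx, hpy⟩

open scoped Classical in
/-- If at least two colours occur and the reserves are large, then all cycles of the same colour can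
be merged into one. -/
theorem IsReservedSystem.exists_merged {S : Multiset (ι × List V × List V)}
    (hS : IsReservedSystem S) (hlong : ∀ x ∈ S, 2 * S.card ≤ x.2.2.length)
    (hcol : ∀ i, ∃ x ∈ S, x.1 ≠ i) :
    ∃ T : Multiset (ι × List V), (∀ x ∈ T, 3 ≤ x.2.length) ∧ (∀ i v, occ T i v ≤ 1) ∧
      (T.map fun x => cycleParity x.2).sum = ((unreserve S).map fun x => cycleParity x.2).sum ∧
      ∀ i, (T.filter fun x => x.1 = i).card ≤ 1 := by
  induction hn : S.card generalizing S with
  | zero =>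
    rw [Multiset.card_eq_zero] at hn
    subst hn
    exact ⟨0, by simp, by simp [occ], by simp [unreserve], by simp⟩
  | succ n ih =>
  by_cases hone : ∀ i, ((unreserve S).filter fun x => x.1 = i).card ≤ 1
  · refine ⟨unreserve S, fun x hx => ?_, hS.occ_le, rfl, hone⟩
    obtain ⟨y, hy, rfl⟩ := Multiset.mem_map.1 hx
    exact hS.three_le y hy
  push Not at hone
  obtain ⟨i, hi⟩ := hone
  have hi' : 2 ≤ (S.filter fun x => x.1 = i).card := by
    rw [unreserve, Multiset.filter_map, Multiset.card_map] at hi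
    exact hi
  obtain ⟨⟨i₁, A, sA⟩, ⟨i₂, B, sB⟩, R, rfl, h1, h2⟩ := exists_cons_cons_of_two_le_card_filter hi'
  simp only at h1 h2
  subst h1; subst h2
  obtain ⟨⟨j, X, sX⟩, hx, hji⟩ := hcol i₂
  simp only at hji
  have hxR : (j, X, sX) ∈ R := by
    simp only [Multiset.mem_cons, Prod.mk.injEq] at hx
    tauto
  obtain ⟨R, rfl⟩ := Multiset.exists_cons_of_mem hxR
  have hl := fun x hx => (hlong x hx)
  simp only [Multiset.card_cons] at hn hl
  obtain ⟨rA, a₂, a₁, rfl⟩ := exists_append_pair (l := sA)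
    (by have := hl (i₂, A, sA) (by simp); simp only at this; lia)
  obtain ⟨rB, b₁, b₂, rfl⟩ := exists_append_pair (l := sB)
    (by have := hl (i₂, B, sB) (by simp); simp only at this; lia)
  obtain ⟨rX, x₂, x₁, rfl⟩ := exists_append_pair (l := sX)
    (by have := hl (j, X, sX) (by simp); simp only at this; lia)
  -- Three cycles become two and the reserves lose two vertices, which preserves the bound `2 *
  -- S.card`. Both colours survive, so a second colour remains available.
  obtain ⟨T, hT3, hTo, hTs, hT1⟩ := ih (hS.merge (Ne.symm hji)) (by
      intro x hx
      simp only [Multiset.card_cons]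
      simp only [Multiset.mem_cons] at hx
      rcases hx with rfl | rfl | hx
      · have := hl (i₂, A, rA ++ [a₂, a₁]) (by simp)
        simp only [List.length_append, List.length_cons, List.length_nil] at this ⊢; lia
      · have := hl (j, X, rX ++ [x₂, x₁]) (by simp)
        simp only [List.length_append, List.length_cons, List.length_nil] at this ⊢; lia
      · have := hl x (by simp [hx]); lia) (by
      intro l
      by_cases hlj : l = j
      · exact ⟨_, Multiset.mem_cons_self _ _, by simp only [hlj]; exact Ne.symm hji⟩
      · exact ⟨_, Multiset.mem_cons_of_mem (Multiset.mem_cons_self _ _), Ne.symm hlj⟩)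
    (by simp only [Multiset.card_cons]; lia)
  refine ⟨T, hT3, hTo, hTs.trans ?_, hT1⟩
  simp only [unreserve_cons, Multiset.map_cons, Multiset.sum_cons]
  have := cycleParity_hexagon (A ++ rA) (B ++ rB) (X ++ rX) a₁ a₂ b₁ b₂ x₁ x₂
  simp only [List.append_assoc] at this ⊢
  rw [← add_assoc, ← this]
  abel

end Merge

theorem c2_le_of_card_filter_le {V : Type u} {k : ℕ} (G : SimpleGraph V)
    (T : Multiset (Fin k × List V)) (h3 : ∀ x ∈ T, 3 ≤ x.2.length) (hocc : ∀ i v, occ T i v ≤ 1)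
    (hT : (T.map fun x => cycleParity x.2).sum = edgeParity G)
    (h1 : ∀ i, (T.filter fun x => x.1 = i).card ≤ 1) : c2 G ≤ k := by
  classical
  have hcard : T.card ≤ k := by
    have : (T.map fun x => (fun _ : List V => 1) x.2).sum = T.card := by simp
    rw [← this, sum_eq_sum_filter_fst T fun _ => 1]
    calc _ ≤ ∑ i : Fin k, 1 := Finset.sum_le_sum fun i _ => by
            have := h1 i
            rw [Multiset.map_const', Multiset.sum_replicate, Multiset.card_map]
            simpa using this
      _ = k := by simp
  refine (c2_le_of_lists G (T.map Prod.snd).toList (fun l hl => ?_) fun e => ?_).trans ?_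
  · rw [Multiset.mem_toList] at hl
    obtain ⟨x, hx, rfl⟩ := Multiset.mem_map.1 hl
    refine ⟨List.nodup_iff_count_le_one.2 fun v => ?_, h3 x hx⟩
    have := hocc x.1 v
    obtain ⟨R, rfl⟩ := Multiset.exists_cons_of_mem hx
    rw [occ_cons, if_pos rfl] at this
    have h := Nat.le_of_add_right_le this
    convert h
  · rw [← hT, sum_fun_apply, ← Multiset.sum_coe, ← Multiset.map_coe, Multiset.coe_toList,
      Multiset.map_map]
    rfl
  · rw [Multiset.length_toList, Multiset.card_map]
    exact_mod_cast hcard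

/-! ### Creating reserves by subdivision -/

section Subdivide

theorem cycleParity_closing_edge {V : Type*} {a b : V} {m : List V}
    (hnd : (a :: (m ++ [b])).Nodup) (hm : m ≠ []) : cycleParity (a :: (m ++ [b])) s(b, a) = 1 := by
  rw [cycleParity_cons_append_singleton]
  obtain ⟨c, m, rfl⟩ := List.exists_cons_of_ne_nil hm
  have h1 : pathParity (c :: (m ++ [b])) s(b, a) = 0 := by
    by_contra h
    have := mem_of_pathParity_ne_zero h (Sym2.mem_mk_right b a)
    simp_all
  have h2 : pairParity a c s(b, a) = 0 := by
    simp only [List.cons_append, List.nodup_cons, List.mem_cons, List.mem_append,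
      List.not_mem_nil, or_false, not_or] at hnd
    have h1 : a ≠ c := hnd.1.1
    have h2 : c ≠ b := hnd.2.1.2
    simp only [pairParity]
    rw [if_neg]
    intro h
    rcases Sym2.eq_iff.1 h with h | h <;> grind
  rw [List.cons_append, pathParity_cons_cons]
  simp only [Pi.add_apply, h1, h2]
  simp [pairParity]

theorem cycleParity_map_none {V : Type*} (l : List V) (o : Option V) :
    cycleParity (l.map some) s(none, o) = 0 := by
  by_contra h
  have := mem_of_cycleParity_ne_zero h (Sym2.mem_mk_left none o)
  simp at this

theorem edgeMult_cons {V ι : Type*} (x : ι × List V) (S : Multiset (ι × List V)) (e : Sym2 V) :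
    edgeMult (x ::ₘ S) e = (cycleParity x.2 e).val + edgeMult S e := by
  simp [edgeMult]

/-- Relabel all vertices. -/
def mapSystem {V W ι : Type*} (f : V → W) (S : Multiset (ι × List V × List V)) :
    Multiset (ι × List W × List W) :=
  S.map fun x => (x.1, x.2.1.map f, x.2.2.map f)

section mapSystem

variable {V W ι : Type*} {f : V → W}

theorem mapSystem_cons (x : ι × List V × List V) (S : Multiset (ι × List V × List V)) :
    mapSystem f (x ::ₘ S) = (x.1, x.2.1.map f, x.2.2.map f) ::ₘ mapSystem f S := by
  simp [mapSystem]

theorem occ_mapSystem (hf : Function.Injective f) (S : Multiset (ι × List V × List V)) (i : ι)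
    (v : V) : occ (unreserve (mapSystem f S)) i (f v) = occ (unreserve S) i v := by
  classical
  induction S using Multiset.induction_on with
  | empty => simp [mapSystem, unreserve, occ]
  | cons x S ih =>
    rw [mapSystem_cons, unreserve_cons, unreserve_cons, occ_cons, occ_cons, ih]
    simp only [← List.map_append]
    congr 2
    convert List.count_map_of_injective _ f hf v

theorem totalCount_mapSystem (hf : Function.Injective f) (S : Multiset (ι × List V × List V))
    (v : V) : totalCount (mapSystem f S) (f v) = totalCount S v := by
  classical
  induction S using Multiset.induction_on with
  | empty => simp [mapSystem, totalCount]
  | cons x S ih =>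
    rw [mapSystem_cons, totalCount_cons, totalCount_cons, ih]
    simp only [← List.map_append]
    congr 1
    convert List.count_map_of_injective _ f hf v

theorem totalCount_mapSystem_of_notMem {w : W} (hw : w ∉ Set.range f)
    (S : Multiset (ι × List V × List V)) : totalCount (mapSystem f S) w = 0 := by
  classical
  induction S using Multiset.induction_on with
  | empty => simp [mapSystem, totalCount]
  | cons x S ih =>
    rw [mapSystem_cons, totalCount_cons, ih, add_zero, ← List.map_append, List.count_eq_zero]
    intro h
    obtain ⟨v, -, rfl⟩ := List.mem_map.1 h
    exact hw ⟨v, rfl⟩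

theorem edgeMult_mapSystem (hf : Function.Injective f) (S : Multiset (ι × List V × List V))
    (e : Sym2 V) :
    edgeMult (unreserve (mapSystem f S)) (e.map f) = edgeMult (unreserve S) e := by
  induction S using Multiset.induction_on with
  | empty => simp [mapSystem, unreserve, edgeMult]
  | cons x S ih =>
    rw [mapSystem_cons, unreserve_cons, unreserve_cons, edgeMult_cons, edgeMult_cons, ih]
    simp only [← List.map_append, cycleParity_map hf]

theorem edgeMult_mapSystem_none (S : Multiset (ι × List V × List V)) (o : Option V) :
    edgeMult (unreserve (mapSystem some S)) s(none, o) = 0 := by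
  induction S using Multiset.induction_on with
  | empty => simp [mapSystem, unreserve, edgeMult]
  | cons x S ih =>
    rw [mapSystem_cons, unreserve_cons, edgeMult_cons, ih]
    simp only [← List.map_append, cycleParity_map_none, ZMod.val_zero]

end mapSystem

variable {ι : Type*}

/-- A reserved system that decomposes the edges of `G`. -/
structure IsReservedDecomposition {V : Type u} (G : SimpleGraph V)
    (S : Multiset (ι × List V × List V)) : Prop extends IsReservedSystem S where
  edgeMult_eq : ∀ e, edgeMult (unreserve S) e = (edgeParity G e).val

theorem nodup_of_occ_le {V : Type*} {x : ι × List V × List V} {S : Multiset (ι × List V × List V)}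
    (hx : x ∈ S) (h : ∀ i v, occ (unreserve S) i v ≤ 1) : (x.2.1 ++ x.2.2).Nodup := by
  classical
  obtain ⟨R, rfl⟩ := Multiset.exists_cons_of_mem hx
  refine List.nodup_iff_count_le_one.2 fun v => ?_
  have := h x.1 v
  rw [unreserve_cons, occ_cons, if_pos rfl] at this
  exact Nat.le_of_add_right_le this

theorem edgeParity_val_eq_one_iff {V : Type*} {G : SimpleGraph V} {e : Sym2 V} :
    (edgeParity G e).val = 1 ↔ e ∈ G.edgeSet := by
  by_cases h : e ∈ G.edgeSet <;> simp [edgeParity, h, ZMod.val_one]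

theorem edgeParity_of_mem {V : Type*} {G : SimpleGraph V} {e : Sym2 V} (h : e ∈ G.edgeSet) :
    edgeParity G e = 1 := if_pos h

theorem edgeParity_of_notMem {V : Type*} {G : SimpleGraph V} {e : Sym2 V} (h : e ∉ G.edgeSet) :
    edgeParity G e = 0 := if_neg h

theorem count_self_map_append {V W : Type*} {_ : DecidableEq W} {f : V → W} {w : W}
    (hw : ∀ v, f v ≠ w) (B r : List V) : (B.map f ++ (r.map f ++ [w])).count w = 1 := by
  have h : ∀ l : List V, (l.map f).count w = 0 := fun l => by
    rw [List.count_eq_zero]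
    intro h
    obtain ⟨v, -, hv⟩ := List.mem_map.1 h
    exact hw v hv
  rw [List.count_append, List.count_append, h, h]
  simp

theorem count_apply_map_append {V W : Type*} {_ : DecidableEq V} {_ : DecidableEq W} {f : V → W}
    (hf : Function.Injective f) {w : W} (hw : ∀ v, f v ≠ w) (B r : List V) (v : V) :
    (B.map f ++ (r.map f ++ [w])).count (f v) = (B ++ r).count v := by
  rw [← List.append_assoc, ← List.map_append, List.count_append,
    List.count_map_of_injective _ _ hf, List.count_eq_zero (l := [w]) |>.2 (by simpa using hw v), add_zero]

/-- One can subdivide an edge of any cycle and put the new vertex in reserve. -/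
theorem IsReservedDecomposition.exists_subdivide {V : Type u} {G : SimpleGraph V} {i : ι}
    {B r : List V} {R : Multiset (ι × List V × List V)}
    (h : IsReservedDecomposition G ((i, B, r) ::ₘ R)) :
    ∃ a b, G.Adj a b ∧ IsReservedDecomposition (subdivideEdge G a b)
      ((i, B.map some, r.map some ++ [none]) ::ₘ mapSystem some R) := by
  classical
  obtain ⟨⟨h3, hocc, hcnt⟩, hmult⟩ := h
  have hinj : Function.Injective (some : V → Option V) := Option.some_injective V
  have hlen := h3 (i, B, r) (by simp)
  have hnd := nodup_of_occ_le (x := (i, B, r)) (by simp) hocc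
  simp only at hlen hnd
  -- The edge to subdivide is the one from the last to the first vertex of the list, so that the new
  -- vertex goes to the end of the reserve.
  obtain ⟨a, b, m, hl⟩ := exists_eq_cons_append_singleton (l := B ++ r) (by lia)
  have hm : m ≠ [] := by rintro rfl; rw [hl] at hlen; simp at hlen
  rw [hl] at hnd
  have hclose := cycleParity_closing_edge hnd hm
  -- This cycle alone contributes 1 to a multiplicity that is less than 2, so the pair is an edge of
  -- `G`.
  have hba : G.Adj b a := by
    have h1 := hmult s(b, a)
    rw [unreserve_cons, edgeMult_cons] at h1
    simp only [hl, hclose, ZMod.val_one] at h1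
    have h2 := ZMod.val_lt (edgeParity G s(b, a))
    have h3 : (edgeParity G s(b, a)).val = 1 := by lia
    exact edgeParity_val_eq_one_iff.1 h3
  have hne := hba.ne
  have hl' : B.map some ++ (r.map some ++ [none]) =
      some a :: ((m.map some ++ [some b]) ++ [none]) := by
    rw [← List.append_assoc, ← List.map_append, hl]; simp
  have hcyc : cycleParity (B.map some ++ (r.map some ++ [none])) =
      pathParity ((a :: (m ++ [b])).map some) + pairParity (some b) none +
        pairParity none (some a) := by
    rw [hl', cycleParity_cons_append_singleton]
    have := pathParity_append_cons_cons (some a :: m.map some) (some b) none []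
    simp only [List.cons_append, pathParity_singleton, add_zero] at this
    simp [this]
  refine ⟨b, a, hba, ⟨⟨?_, fun l v => ?_, ?_⟩, fun e => ?_⟩⟩
  · intro x hx
    rcases Multiset.mem_cons.1 hx with rfl | hx
    · have : (B.map some ++ (r.map some ++ [none])).length = (B ++ r).length + 1 := by simp; lia
      simp only; lia
    · obtain ⟨y, hy, rfl⟩ := Multiset.mem_map.1 hx
      have := h3 y (by simp [hy])
      simpa using this
  · rw [unreserve_cons, occ_cons]
    cases v with
    | none =>
      have h1 := occ_le_totalCount (mapSystem some R) l none
      rw [totalCount_mapSystem_of_notMem (by simp)] at h1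
      simp only
      rw [count_self_map_append Option.some_ne_none]
      split_ifs <;> lia
    | some v =>
      have h1 := hocc l v
      rw [unreserve_cons, occ_cons] at h1
      rw [occ_mapSystem hinj]
      simp only
      rw [count_apply_map_append hinj Option.some_ne_none]
      exact h1
  · have hnone : totalCount ((i, B.map some, r.map some ++ [none]) ::ₘ mapSystem some R) none
        ≤ 1 := by
      rw [totalCount_cons, totalCount_mapSystem_of_notMem (by simp)]
      simp only
      rw [count_self_map_append Option.some_ne_none]
    have hsome : ∀ v, totalCount ((i, B.map some, r.map some ++ [none]) ::ₘ mapSystem some R)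
        (some v) = totalCount ((i, B, r) ::ₘ R) v := by
      intro v
      rw [totalCount_cons, totalCount_cons, totalCount_mapSystem hinj]
      simp only
      rw [count_apply_map_append hinj Option.some_ne_none]
    intro x hx v hv
    cases v with
    | none => exact hnone
    | some v =>
      rw [hsome]
      rcases Multiset.mem_cons.1 hx with rfl | hx
      · exact hcnt (i, B, r) (by simp) v (by simpa using hv)
      · obtain ⟨y, hy, rfl⟩ := Multiset.mem_map.1 hx
        exact hcnt y (by simp [hy]) v (by simpa using hv)
  · rw [unreserve_cons, edgeMult_cons]
    simp only [hcyc, Pi.add_apply]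
    induction e using Sym2.ind with
    | _ x y =>
    have hnone : ∀ o, ((pathParity ((a :: (m ++ [b])).map some) s(none, o) +
        pairParity (some b) none s(none, o) + pairParity none (some a) s(none, o)).val +
        edgeMult (unreserve (mapSystem some R)) s(none, o)) =
        (edgeParity (subdivideEdge G b a) s(none, o)).val := by
      intro o
      have h0 : pathParity ((a :: (m ++ [b])).map some) s(none, o) = 0 := by
        by_contra h
        have := mem_of_pathParity_ne_zero h (Sym2.mem_mk_left none o)
        simp at this
      rw [h0, edgeMult_mapSystem_none]
      cases o with
      | none =>
        rw [edgeParity_of_notMem (by simp)]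
        simp [pairParity]
      | some x =>
        have h1 : s(none, some x) ∈ (subdivideEdge G b a).edgeSet ↔ x = b ∨ x = a := by
          rw [Sym2.eq_swap, mem_edgeSet, subdivideEdge_adj_none]
        by_cases hx : x = b
        · rw [edgeParity_of_mem (h1.2 (.inl hx))]
          simp [pairParity, hx, hne]
        · by_cases hx' : x = a
          · rw [edgeParity_of_mem (h1.2 (.inr hx'))]
            simp [pairParity, hx', Ne.symm hne]
          · rw [edgeParity_of_notMem (by rw [h1]; tauto)]
            simp [pairParity, hx, hx']
    cases x with
    | none => exact hnone y
    | some x =>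
      cases y with
      | none => rw [Sym2.eq_swap]; exact hnone (some x)
      | some y =>
        have h0 := hmult s(x, y)
        rw [unreserve_cons, edgeMult_cons] at h0
        simp only [hl] at h0
        have h1 : s(some x, some y) = Sym2.map some s(x, y) := rfl
        have h2 : pairParity (some b) none s(some x, some y) = 0 := by simp [pairParity]
        have h3 : pairParity none (some a) s(some x, some y) = 0 := by simp [pairParity]
        have h4 : s(some x, some y) ∈ (subdivideEdge G b a).edgeSet ↔
            s(x, y) ∈ G.edgeSet ∧ s(x, y) ≠ s(b, a) := subdivideEdge_adj_some
        rw [h2, h3, add_zero, add_zero, h1, edgeMult_mapSystem hinj, pathParity_map hinj, ← h1]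
        -- Among the old pairs only the subdivided one changes: the opened cycle no longer uses it,
        -- and no other cycle did.
        by_cases he : s(x, y) = s(b, a)
        · have h5 := hclose
          rw [cycleParity_cons_append_singleton] at h5
          have h6 : pairParity b a s(b, a) = 1 := by simp [pairParity]
          rw [Pi.add_apply, h6, add_eq_right] at h5
          rw [edgeParity_of_notMem (by rw [h4]; tauto), he, h5]
          rw [he, edgeParity_of_mem hba, hclose] at h0
          simpa [ZMod.val_one] using h0
        · rw [cycleParity_cons_append_singleton, Pi.add_apply] at h0
          have h6 : pairParity b a s(x, y) = 0 := by simp only [pairParity, if_neg he]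
          rw [h6, add_zero] at h0
          rw [h0]
          by_cases hG : s(x, y) ∈ G.edgeSet
          · rw [edgeParity_of_mem hG, edgeParity_of_mem (h4.2 ⟨hG, he⟩)]
          · rw [edgeParity_of_notMem hG, edgeParity_of_notMem (by rw [h4]; tauto)]

/-- Some subdivision of `G` has a decomposition with large reserves. -/
theorem IsReservedDecomposition.exists_long {V : Type u} {G : SimpleGraph V}
    {S : Multiset (ι × List V × List V)} (h : IsReservedDecomposition G S) (n : ℕ) :
    ∃ (W : Type u) (H : SimpleGraph W) (T : Multiset (ι × List W × List W)), IsSubdivision G H ∧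
      IsReservedDecomposition H T ∧ (∀ x ∈ T, n ≤ x.2.2.length) ∧
      T.map Prod.fst = S.map Prod.fst := by
  -- The induction is on the total shortfall of the reserves; each subdivision lowers it by one and
  -- changes the vertex type.
  induction hd : (S.map fun x => n - x.2.2.length).sum generalizing V with
  | zero =>
    refine ⟨V, G, S, .of_iso .refl, h, fun x hx => ?_, rfl⟩
    have := Multiset.le_sum_of_mem (Multiset.mem_map_of_mem (fun x => n - x.2.2.length) hx)
    lia
  | succ d ih =>
    obtain ⟨x, hx, hxn⟩ : ∃ x ∈ S, x.2.2.length < n := by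
      by_contra! hlong
      have : (S.map fun x => n - x.2.2.length).sum = 0 := by
        rw [Multiset.sum_eq_zero_iff]
        intro y hy
        obtain ⟨x, hx, rfl⟩ := Multiset.mem_map.1 hy
        have := hlong x hx
        lia
      lia
    obtain ⟨R, rfl⟩ := Multiset.exists_cons_of_mem hx
    obtain ⟨i, B, r⟩ := x
    obtain ⟨a, b, hab, h'⟩ := h.exists_subdivide
    obtain ⟨W, H, T, hH, hT, hTn, hTf⟩ := ih h' (by
      simp only [Multiset.map_cons, Multiset.sum_cons, mapSystem, Multiset.map_map,
        Function.comp_def, List.length_append, List.length_map, List.length_singleton] at hd hxn ⊢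
      lia)
    refine ⟨W, H, T, .step hab hH, hT, hTn, hTf.trans ?_⟩
    simp [mapSystem]

end Subdivide

/-! ### The bounds in terms of the maximum degree -/

theorem sum_cycleParity_eq_edgeParity {V ι : Type*} {G : SimpleGraph V}
    {S : Multiset (ι × List V)} (h : ∀ e, edgeMult S e = (edgeParity G e).val) :
    (S.map fun x => cycleParity x.2).sum = edgeParity G := by
  funext e
  rw [sum_cycleParity_eq_edgeMult, h, ZMod.natCast_zmod_val]

theorem c2_le_maxDegree {V : Type u} [Fintype V] (G : SimpleGraph V) [DecidableRel G.Adj]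
    (hG : ∀ v, Even (G.degree v)) {k : ℕ} (hk : G.maxDegree = 2 * k) :
    c2 G ≤ G.maxDegree := by
  obtain ⟨S, h3, hocc, hmult, -⟩ := exists_cycle_system G hG k hk
  rw [hk]
  exact c2_le_two_mul G S h3 hocc (sum_cycleParity_eq_edgeParity hmult)

theorem isUnionOfTwoOrMoreDisjointCycles_of_lists {V : Type u} {G : SimpleGraph V}
    {L : List (List V)} (h2 : 2 ≤ L.length) (h3 : ∀ l ∈ L, l.Nodup ∧ 3 ≤ l.length)
    (hdisj : L.Pairwise List.Disjoint)
    (hG : ∀ e, e ∈ G.edgeSet ↔ ∃ l ∈ L, cycleParity l e ≠ 0) :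
    IsUnionOfTwoOrMoreDisjointCycles G := by
  have hmem : ∀ l ∈ L, ∀ e, e ∈ (cycleOfList l).edgeSet ↔ cycleParity l e ≠ 0 := fun l hl e =>
    mem_edgeSet_cycleOfList (h3 l hl).1 (by have := (h3 l hl).2; lia)
  have hsupp : ∀ l ∈ L, ∀ v ∈ (cycleOfList l).support, v ∈ l := by
    rintro l hl v ⟨w, hvw⟩
    exact mem_of_cycleParity_ne_zero ((hmem l hl s(v, w)).1 hvw) (Sym2.mem_mk_left v w)
  refine ⟨L.length, fun i => cycleOfList L[i], h2, fun i => ?_, fun i j hij => ?_, ?_⟩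
  · exact isCycleGraph_cycleOfList (h3 _ (by simp)).1 (h3 _ (by simp)).2
  · rw [Set.disjoint_left]
    intro v hi hj
    have hi' := hsupp _ (by simp) v hi
    have hj' := hsupp _ (by simp) v hj
    rcases lt_or_gt_of_ne hij with h | h
    · exact List.pairwise_iff_getElem.1 hdisj i j i.2 j.2 h hi' hj'
    · exact List.pairwise_iff_getElem.1 hdisj j i j.2 i.2 h hj' hi'
  · ext e
    rw [hG, Set.mem_iUnion]
    constructor
    · rintro ⟨l, hl, he⟩
      obtain ⟨n, hn, rfl⟩ := List.getElem_of_mem hl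
      exact ⟨⟨n, hn⟩, (hmem _ hl e).2 he⟩
    · rintro ⟨i, hi⟩
      exact ⟨L[i], by simp, (hmem _ (by simp) e).1 hi⟩

open scoped Classical in
theorem pairwise_disjoint_of_sum_count_le_one {V : Type*} {L : List (List V)}
    (h : ∀ v, (L.map (List.count v)).sum ≤ 1) : L.Pairwise List.Disjoint := by
  induction L with
  | nil => exact .nil
  | cons l L ih =>
    simp only [List.map_cons, List.sum_cons] at h
    refine .cons (fun l' hl' v hv hv' => ?_) (ih fun v => by have := h v; lia)
    have h1 := List.count_pos_iff.2 hv
    have h2 := List.count_pos_iff.2 hv'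
    have h3 := List.le_sum_of_mem (List.mem_map_of_mem (f := List.count v) hl')
    have := h v
    lia

/-- With only one colour all cycles are vertex-disjoint, which is the exceptional case of the
theorem. -/
theorem isUnionOfTwoOrMoreDisjointCycles_of_system {V : Type u} {G : SimpleGraph V} {ι : Type*}
    [Subsingleton ι] {S : Multiset (ι × List V)} (h2 : 2 ≤ S.card)
    (h3 : ∀ x ∈ S, 3 ≤ x.2.length) (hocc : ∀ i v, occ S i v ≤ 1)
    (hmult : ∀ e, edgeMult S e = (edgeParity G e).val) :
    IsUnionOfTwoOrMoreDisjointCycles G := by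
  classical
  have hcount : ∀ v, (S.map fun x => x.2.count v).sum ≤ 1 := by
    intro v
    obtain ⟨x, -⟩ := Multiset.card_pos_iff_exists_mem.1 (by lia : 0 < S.card)
    have := hocc x.1 v
    rw [occ] at this
    simpa only [Subsingleton.elim _ x.1, if_true] using this
  refine isUnionOfTwoOrMoreDisjointCycles_of_lists (L := (S.map Prod.snd).toList) (by simpa)
    (fun l hl => ?_) (pairwise_disjoint_of_sum_count_le_one fun v => ?_) fun e => ?_
  · rw [Multiset.mem_toList] at hl
    obtain ⟨x, hx, rfl⟩ := Multiset.mem_map.1 hl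
    refine ⟨List.nodup_iff_count_le_one.2 fun v => le_trans ?_ (hcount v), h3 x hx⟩
    exact Multiset.le_sum_of_mem (Multiset.mem_map_of_mem (fun x => x.2.count v) hx)
  · rw [← Multiset.sum_coe, ← Multiset.map_coe, Multiset.coe_toList, Multiset.map_map]
    exact hcount v
  · have h0 : e ∉ G.edgeSet ↔ edgeMult S e = 0 := by
      rw [hmult, ZMod.val_eq_zero]
      constructor
      · exact edgeParity_of_notMem
      · intro h h'
        rw [edgeParity_of_mem h'] at h
        exact one_ne_zero h
    rw [← not_iff_not, h0, edgeMult, Multiset.sum_eq_zero_iff]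
    simp only [Multiset.mem_map, Multiset.mem_toList]
    constructor
    · rintro h ⟨_, ⟨x, hx, rfl⟩, he⟩
      exact he ((ZMod.val_eq_zero _).1 (h _ ⟨x, hx, rfl⟩))
    · rintro h _ ⟨x, hx, rfl⟩
      by_contra h'
      exact h ⟨_, ⟨x, hx, rfl⟩, fun h0 => h' (by rw [h0, ZMod.val_zero])⟩

theorem c2Top_le {V : Type u} [Fintype V] (G : SimpleGraph V) [DecidableRel G.Adj]
    (hG : ∀ v, Even (G.degree v)) {k : ℕ} (hk : G.maxDegree = 2 * k)
    (hU : ¬ IsUnionOfTwoOrMoreDisjointCycles G) : c2Top G ≤ k := by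
  classical
  obtain ⟨S, h3, hocc, hmult, hcol⟩ := exists_cycle_system G hG k hk
  -- If no colour has two cycles, `G` itself serves as the subdivision.
  by_cases h1 : ∀ i, (S.filter fun x => x.1 = i).card ≤ 1
  · refine le_trans (sInf_le ⟨V, G, .of_iso .refl, rfl⟩) ?_
    refine c2_le_of_card_filter_le G S h3 hocc (sum_cycleParity_eq_edgeParity hmult) fun i => ?_
    convert h1 i
  push Not at h1
  obtain ⟨i, hi⟩ := h1
  have hcard : 2 ≤ S.card := hi.trans_le (Multiset.card_le_card (Multiset.filter_le _ _))
  -- Merging needs a second colour; its absence is what `hU` rules out.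
  have hk2 : Nontrivial (Fin k) := by
    by_contra h
    rw [not_nontrivial_iff_subsingleton] at h
    exact hU (isUnionOfTwoOrMoreDisjointCycles_of_system hcard h3 hocc hmult)
  set S₀ : Multiset (Fin k × List V × List V) := S.map fun x => (x.1, x.2, []) with hS₀
  have hun : unreserve S₀ = S := by simp [hS₀, unreserve]
  have hdec : IsReservedDecomposition G S₀ := by
    refine ⟨⟨fun x hx => ?_, by rwa [hun], fun x hx r hr => ?_⟩, by rwa [hun]⟩
    · obtain ⟨y, hy, rfl⟩ := Multiset.mem_map.1 hx
      simpa using h3 y hy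
    · obtain ⟨y, hy, rfl⟩ := Multiset.mem_map.1 hx
      simp at hr
  -- Subdividing preserves the number of cycles and their colours, so the length demanded by the
  -- merging can be fixed in advance.
  obtain ⟨W, H, T, hH, hT, hlong, hfst⟩ := hdec.exists_long (2 * S.card)
  have hcardT : T.card = S.card := by
    rw [← Multiset.card_map Prod.fst T, hfst]
    simp [hS₀]
  obtain ⟨T', hT3, hTocc, hTsum, hT1⟩ := hT.toIsReservedSystem.exists_merged
    (by rwa [hcardT]) (fun i => by
      obtain ⟨j, hj⟩ := exists_ne i
      obtain ⟨x, hx, hxj⟩ := hcol j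
      have : j ∈ T.map Prod.fst := by
        rw [hfst, hS₀, Multiset.map_map]
        exact Multiset.mem_map.2 ⟨x, hx, hxj⟩
      obtain ⟨y, hy, hyj⟩ := Multiset.mem_map.1 this
      exact ⟨y, hy, hyj ▸ hj⟩)
  refine le_trans (sInf_le ⟨W, H, hH, rfl⟩) ?_
  refine c2_le_of_card_filter_le H T' hT3 hTocc
    (hTsum.trans (sum_cycleParity_eq_edgeParity hT.edgeMult_eq)) fun i => ?_
  convert hT1 i

theorem le_c2Top {V : Type u} [Fintype V] (G : SimpleGraph V) [DecidableRel G.Adj] {k : ℕ}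
    (hk : G.maxDegree = 2 * k) : (k : ℕ∞) ≤ c2Top G := by
  refine le_sInf ?_
  rintro _ ⟨W, H, hH, rfl⟩
  by_cases hne : Nonempty V
  · obtain ⟨v, hv⟩ := G.exists_maximal_degree_vertex
    obtain ⟨w, hw⟩ := hH.exists_encard_neighborSet_le v
    have h1 := hw.trans (encard_neighborSet_le_two_mul_c2 H w)
    have h2 : (G.neighborSet v).encard = ((2 * k : ℕ) : ℕ∞) := by
      have := Set.encard_coe_eq_coe_finsetCard (G.neighborFinset v)
      rw [coe_neighborFinset] at this
      rw [this, G.card_neighborFinset_eq_degree, ← hv, hk]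
    rw [h2] at h1
    cases hc : c2 H with
    | top => simp
    | coe n =>
      rw [hc] at h1
      norm_cast at h1 ⊢
      lia
  · rw [not_nonempty_iff] at hne
    have := G.maxDegree_of_subsingleton
    have : k = 0 := by lia
    simp [this]

theorem two_mul_c2Top_eq {V : Type u} [Fintype V] (G : SimpleGraph V) [DecidableRel G.Adj]
    (hG : ∀ v, Even (G.degree v)) {k : ℕ} (hk : G.maxDegree = 2 * k)
    (hU : ¬ IsUnionOfTwoOrMoreDisjointCycles G) : 2 * c2Top G = (G.maxDegree : ℕ∞) := by
  rw [le_antisymm (c2Top_le G hG hk hU) (le_c2Top G hk), hk]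
  norm_cast

theorem exists_maxDegree_eq_two_mul {V : Type u} [Fintype V] (G : SimpleGraph V)
    [DecidableRel G.Adj] (hG : ∀ v, Even (G.degree v)) : ∃ k, G.maxDegree = 2 * k := by
  by_cases hne : Nonempty V
  · obtain ⟨v, hv⟩ := G.exists_maximal_degree_vertex
    rw [hv]
    exact (hG v).exists_two_nsmul
  · rw [not_nonempty_iff] at hne
    exact ⟨0, G.maxDegree_of_subsingleton⟩

/-! ### Ends of paths -/

section Boundary

variable {V : Type*}

/-- The parity of the number of pairs at `v`. -/
noncomputable def boundary [Fintype V] (Φ : Sym2 V → ZMod 2) (v : V) : ZMod 2 := ∑ w, Φ s(v, w)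

theorem boundary_sum [Fintype V] {X : Type*} (S : Multiset X) (f : X → Sym2 V → ZMod 2) (v : V) :
    boundary (S.map f).sum v = (S.map fun x => boundary (f x) v).sum := by
  induction S using Multiset.induction_on with
  | empty => simp [boundary]
  | cons x S ih =>
    rw [Multiset.map_cons, Multiset.sum_cons, Multiset.map_cons, Multiset.sum_cons, ← ih]
    simp [boundary, Finset.sum_add_distrib]

open scoped Classical in
theorem boundary_pairParity [Fintype V] {a b : V} (hab : a ≠ b) (v : V) :
    boundary (pairParity a b) v = (if v = a then 1 else 0) + if v = b then 1 else 0 := by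
  have h : ∀ w, pairParity a b s(v, w) =
      (if v = a then (if w = b then 1 else 0) else 0) +
        (if v = b then (if w = a then 1 else 0) else 0) := by
    intro w
    simp only [pairParity, Sym2.eq_iff]
    by_cases h1 : v = a <;> by_cases h2 : v = b <;> by_cases h3 : w = a <;>
      by_cases h4 : w = b <;> simp_all
  simp only [boundary, h, Finset.sum_add_distrib]
  by_cases h1 : v = a <;> by_cases h2 : v = b <;> simp [h1, h2]

open scoped Classical in
-- Inner vertices are counted twice along the path, so only the two ends survive; they cancel for a
-- single vertex.
theorem boundary_pathParity [Fintype V] {a : V} {l : List V} (hl : (a :: l).Nodup) (v : V) :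
    boundary (pathParity (a :: l)) v = (if v = a then 1 else 0) +
      if v = (a :: l).getLast (List.cons_ne_nil a l) then 1 else 0 := by
  induction l generalizing a with
  | nil =>
    have : boundary (0 : Sym2 V → ZMod 2) v = 0 := by simp [boundary]
    rw [pathParity_singleton, this]
    exact (CharTwo.add_self_eq_zero _).symm
  | cons b l ih =>
    have h1 := ih hl.of_cons
    have hab : a ≠ b := by
      rintro rfl
      simp at hl
    have h2 : boundary (pathParity (a :: b :: l)) v =
        boundary (pairParity a b) v + boundary (pathParity (b :: l)) v := by
      simp [boundary, Finset.sum_add_distrib]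
    rw [h2, h1, boundary_pairParity hab, List.getLast_cons (List.cons_ne_nil b l)]
    have h3 := CharTwo.add_self_eq_zero (if v = b then (1 : ZMod 2) else 0)
    linear_combination h3

theorem boundary_pathParity_eq_one [Fintype V] {l : List V} {a : V} (hl : (l ++ [a]).Nodup)
    (hne : l ≠ []) : boundary (pathParity (l ++ [a])) a = 1 := by
  classical
  obtain ⟨b, l, rfl⟩ := List.exists_cons_of_ne_nil hne
  have h := boundary_pathParity (a := b) (l := l ++ [a]) hl a
  have hab : a ≠ b := by
    rintro rfl
    simp at hl
  simpa [hab] using h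

/-- Replace the list `l` by its reversal, if necessary, so that it ends in `v`. -/
theorem exists_append_of_boundary_ne_zero [Fintype V] {l : List V} {v : V} (hl : l.Nodup)
    (h : boundary (pathParity l) v ≠ 0) : ∃ t, l = t ++ [v] ∨ l.reverse = t ++ [v] := by
  classical
  cases l with
  | nil => simp [boundary] at h
  | cons a l =>
    rw [boundary_pathParity hl] at h
    by_cases h1 : v = a
    · exact ⟨l.reverse, .inr (by simp [h1])⟩
    · by_cases h2 : v = (a :: l).getLast (List.cons_ne_nil a l)
      · exact ⟨(a :: l).dropLast, .inl (by rw [h2, List.dropLast_append_getLast])⟩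
      · simp [h1, h2] at h

end Boundary

/-! ### Joining paths through fresh vertices -/

section PathSystem

variable {V ι : Type*}

/-- `S` consists of coloured paths such that those of the same colour are vertex-disjoint; its sum
is `Φ`, and the vertices in `Z` are not used by `S`. -/
structure IsPathSystem (Φ : Sym2 V → ZMod 2) (Z : List V) (S : Multiset (ι × List V)) : Prop where
  two_le : ∀ x ∈ S, 2 ≤ x.2.length
  occ_le : ∀ i v, occ S i v ≤ 1
  sum_eq : (S.map fun x => pathParity x.2).sum = Φ
  fresh : ∀ z ∈ Z, ∀ i, occ S i z = 0

theorem IsPathSystem.nodup {Φ : Sym2 V → ZMod 2} {Z : List V} {S : Multiset (ι × List V)}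
    (h : IsPathSystem Φ Z S) {x : ι × List V} (hx : x ∈ S) : x.2.Nodup := by
  classical
  obtain ⟨R, rfl⟩ := Multiset.exists_cons_of_mem hx
  refine List.nodup_iff_count_le_one.2 fun v => ?_
  have := h.occ_le x.1 v
  rw [occ_cons, if_pos rfl] at this
  exact Nat.le_of_add_right_le this

theorem IsPathSystem.reverse {Φ : Sym2 V → ZMod 2} {Z : List V} {R : Multiset (ι × List V)} {i : ι}
    {l : List V} (h : IsPathSystem Φ Z ((i, l) ::ₘ R)) :
    IsPathSystem Φ Z ((i, l.reverse) ::ₘ R) := by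
  classical
  obtain ⟨h2, hocc, hsum, hfresh⟩ := h
  have h0 : ∀ j v, occ ((i, l.reverse) ::ₘ R) j v = occ ((i, l) ::ₘ R) j v := by
    intro j v
    simp [occ_cons]
  refine ⟨fun x hx => ?_, by simpa only [h0], ?_, by simpa only [h0]⟩
  · rcases Multiset.mem_cons.1 hx with rfl | hx
    · simpa using h2 (i, l) (by simp)
    · exact h2 x (by simp [hx])
  · simpa [pathParity_reverse] using hsum

theorem IsPathSystem.reorient {Φ : Sym2 V → ZMod 2} {Z : List V} {R : Multiset (ι × List V)} {i : ι}
    {l t : List V} (h : IsPathSystem Φ Z ((i, l) ::ₘ R)) (ht : l = t ∨ l.reverse = t) :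
    IsPathSystem Φ Z ((i, t) ::ₘ R) := by
  rcases ht with rfl | rfl
  · exact h
  · exact h.reverse

/-- Join two paths of colour `i`, using a fresh vertex, and prolong two paths of different
colours. -/
theorem IsPathSystem.join_prolong {Φ : Sym2 V → ZMod 2} {Z : List V} {z : V}
    {R : Multiset (ι × List V)} {i j k : ι} (hij : i ≠ j) (hik : i ≠ k) (hjk : j ≠ k) (hz : z ∉ Z)
    {P Q p q : List V} {a b : V}
    (h : IsPathSystem Φ (z :: Z) ((i, P ++ [a]) ::ₘ (i, b :: Q) ::ₘ (j, p ++ [a]) ::ₘ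
      (k, q ++ [b]) ::ₘ R)) :
    IsPathSystem Φ Z ((i, P ++ a :: z :: b :: Q) ::ₘ (j, p ++ [a, z]) ::ₘ
      (k, q ++ [b, z]) ::ₘ R) := by
  classical
  obtain ⟨h2, hocc, hsum, hfresh⟩ := h
  -- The only new visits are to `z`, one in each of the three colours; `z` was unused before.
  have hnew : ∀ l v, occ ((i, P ++ a :: z :: b :: Q) ::ₘ (j, p ++ [a, z]) ::ₘ
      (k, q ++ [b, z]) ::ₘ R) l v = occ ((i, P ++ [a]) ::ₘ (i, b :: Q) ::ₘ (j, p ++ [a]) ::ₘ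
      (k, q ++ [b]) ::ₘ R) l v + if (l = i ∨ l = j ∨ l = k) ∧ v = z then 1 else 0 := by
    intro l v
    simp only [occ_cons, List.count_append, List.count_cons, List.count_nil, beq_iff_eq]
    by_cases hv : v = z
    · by_cases h1 : i = l
      · subst h1; simp [hv, Ne.symm hij, Ne.symm hik]; lia
      by_cases h2 : j = l
      · subst h2; simp [hv, hij, Ne.symm hjk]; lia
      by_cases h3 : k = l
      · subst h3; simp [hv, hik, hjk]; lia
      · simp [h1, h2, h3, Ne.symm h1, Ne.symm h2, Ne.symm h3]
    · simp only [hv, and_false, if_false, Ne.symm hv]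
      split_ifs <;> lia
  refine ⟨?_, fun l v => ?_, ?_, fun z' hz' l => ?_⟩
  · intro x hx
    simp only [Multiset.mem_cons] at hx
    rcases hx with rfl | rfl | rfl | hx
    · simp; lia
    · simp
    · simp
    · exact h2 x (by simp [hx])
  · rw [hnew]
    by_cases hv : v = z
    · subst hv
      rw [hfresh v (by simp) l]
      split_ifs <;> lia
    · simpa [hv] using hocc l v
  · rw [← hsum]
    simp only [Multiset.map_cons, Multiset.sum_cons]
    have h1 := pathParity_append_cons_cons P a z (b :: Q)
    have h2 := pathParity_append_cons_cons p a z []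
    have h3 := pathParity_append_cons_cons q b z []
    rw [h1, h2, h3]
    simp only [pathParity_cons_cons, pathParity_singleton, pairParity_comm z b]
    linear_combination add_self_zmod_two (pairParity a z) + add_self_zmod_two (pairParity b z)
  · rw [hnew, hfresh z' (by simp [hz']), if_neg]
    rintro ⟨-, rfl⟩
    exact hz hz'

/-- Join two paths of colour `i` and two paths of colour `j` in the same way, using a fresh
vertex. -/
theorem IsPathSystem.join_join {Φ : Sym2 V → ZMod 2} {Z : List V} {z : V}
    {R : Multiset (ι × List V)} {i j : ι} (hij : i ≠ j) (hz : z ∉ Z)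
    {P Q p q : List V} {a b : V}
    (h : IsPathSystem Φ (z :: Z) ((i, P ++ [a]) ::ₘ (i, b :: Q) ::ₘ (j, p ++ [a]) ::ₘ
      (j, q ++ [b]) ::ₘ R)) :
    IsPathSystem Φ Z ((i, P ++ a :: z :: b :: Q) ::ₘ (j, p ++ a :: z :: b :: q.reverse) ::ₘ R) := by
  classical
  obtain ⟨h2, hocc, hsum, hfresh⟩ := h
  have hnew : ∀ l v, occ ((i, P ++ a :: z :: b :: Q) ::ₘ (j, p ++ a :: z :: b :: q.reverse) ::ₘ R)
      l v = occ ((i, P ++ [a]) ::ₘ (i, b :: Q) ::ₘ (j, p ++ [a]) ::ₘ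
      (j, q ++ [b]) ::ₘ R) l v + if (l = i ∨ l = j) ∧ v = z then 1 else 0 := by
    intro l v
    simp only [occ_cons, List.count_append, List.count_cons, List.count_nil, beq_iff_eq,
      List.count_reverse]
    by_cases hv : v = z
    · by_cases h1 : i = l
      · subst h1; simp [hv, Ne.symm hij]; lia
      by_cases h2 : j = l
      · subst h2; simp [hv, hij]; lia
      · simp [h1, h2, Ne.symm h1, Ne.symm h2]
    · simp only [hv, and_false, if_false, Ne.symm hv]
      split_ifs <;> lia
  refine ⟨?_, fun l v => ?_, ?_, fun z' hz' l => ?_⟩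
  · intro x hx
    simp only [Multiset.mem_cons] at hx
    rcases hx with rfl | rfl | hx
    · simp; lia
    · simp; lia
    · exact h2 x (by simp [hx])
  · rw [hnew]
    by_cases hv : v = z
    · subst hv
      rw [hfresh v (by simp) l]
      split_ifs <;> lia
    · simpa [hv] using hocc l v
  · rw [← hsum]
    simp only [Multiset.map_cons, Multiset.sum_cons]
    have h1 := pathParity_append_cons_cons P a z (b :: Q)
    have h2 := pathParity_append_cons_cons p a z (b :: q.reverse)
    have h3 := pathParity_reverse (q ++ [b])
    rw [List.reverse_append, List.reverse_singleton, List.singleton_append] at h3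
    rw [h1, h2]
    simp only [pathParity_cons_cons, pairParity_comm z b, h3]
    linear_combination add_self_zmod_two (pairParity a z) + add_self_zmod_two (pairParity b z)
  · rw [hnew, hfresh z' (by simp [hz']), if_neg]
    rintro ⟨-, rfl⟩
    exact hz hz'

/-- Join two paths of colour `i` at the ends `a` and `b`, where different paths of other colours
also end in `a` and `b`. -/
theorem IsPathSystem.exists_join {Φ : Sym2 V → ZMod 2} {Z : List V} {z : V}
    {R : Multiset (ι × List V)} {i j k : ι} (hij : i ≠ j) (hik : i ≠ k) (hz : z ∉ Z)
    {P Q l m p q : List V} {a b : V} (hl : l = p ++ [a] ∨ l.reverse = p ++ [a])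
    (hm : m = q ++ [b] ∨ m.reverse = q ++ [b])
    (h : IsPathSystem Φ (z :: Z) ((i, P ++ [a]) ::ₘ (i, b :: Q) ::ₘ (j, l) ::ₘ (k, m) ::ₘ R)) :
    ∃ T : Multiset (ι × List V), IsPathSystem Φ Z T ∧ T.card < R.card + 4 := by
  have e1 : ∀ l m : List V, (i, P ++ [a]) ::ₘ (i, b :: Q) ::ₘ (j, l) ::ₘ (k, m) ::ₘ R =
      (j, l) ::ₘ (k, m) ::ₘ (i, P ++ [a]) ::ₘ (i, b :: Q) ::ₘ R := by
    intro l m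
    simp only [← Multiset.singleton_add]
    abel
  rw [e1] at h
  replace h := h.reorient hl
  rw [Multiset.cons_swap] at h
  replace h := h.reorient hm
  rw [Multiset.cons_swap, ← e1] at h
  -- If both auxiliary paths have the same colour, prolonging each to `z` would visit `z` twice in
  -- that colour, so they are joined there instead.
  by_cases hjk : j = k
  · subst hjk
    exact ⟨_, h.join_join hij hz, by simp⟩
  · exact ⟨_, h.join_prolong hij hik hjk hz, by simp⟩

/-- As the total boundary at `v` vanishes, an end of one path is an end of another. -/
theorem exists_boundary_ne_zero [Fintype V] {R : Multiset (ι × List V)} {l : List V} {v : V}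
    {i : ι} (h0 : boundary (((i, l) ::ₘ R).map fun x => pathParity x.2).sum v = 0)
    (h1 : boundary (pathParity l) v = 1) : ∃ x ∈ R, boundary (pathParity x.2) v ≠ 0 := by
  by_contra! h
  rw [boundary_sum, Multiset.map_cons, Multiset.sum_cons, h1, Multiset.map_congr rfl h] at h0
  simp at h0

theorem IsPathSystem.fst_ne {Φ : Sym2 V → ZMod 2} {Z : List V} {R : Multiset (ι × List V)} {i : ι}
    {l : List V} (h : IsPathSystem Φ Z ((i, l) ::ₘ R)) {x : ι × List V} (hx : x ∈ R) {v : V}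
    (hv : v ∈ l) (hvx : v ∈ x.2) : i ≠ x.1 := by
  classical
  rintro rfl
  obtain ⟨R, rfl⟩ := Multiset.exists_cons_of_mem hx
  have h1 := h.occ_le x.1 v
  rw [occ_cons, occ_cons, if_pos rfl, if_pos rfl] at h1
  have h2 := List.count_pos_iff.2 hv
  have h3 := List.count_pos_iff.2 hvx
  simp only at h1
  lia

theorem mem_of_boundary_ne_zero [Fintype V] {l : List V} {v : V} (hl : l.Nodup)
    (h : boundary (pathParity l) v ≠ 0) : v ∈ l := by
  obtain ⟨t, ht | ht⟩ := exists_append_of_boundary_ne_zero hl h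
  · simp [ht]
  · rw [← List.mem_reverse, ht]; simp

open scoped Classical in
-- The paths to be joined end in `a` and in `b`, `c`. At each of these vertices another path ends,
-- of a different colour since paths of one colour are disjoint. Joining needs two different
-- auxiliary paths, and one of the pairs `a, b` and `a, c` provides them.
theorem IsPathSystem.exists_smaller [Fintype V] {Φ : Sym2 V → ZMod 2} (hΦ : ∀ v, boundary Φ v = 0)
    {Z : List V} {z : V} (hz : z ∉ Z) {S : Multiset (ι × List V)} (h : IsPathSystem Φ (z :: Z) S)
    {i : ι} (hi : 2 ≤ (S.filter fun x => x.1 = i).card) :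
    ∃ T : Multiset (ι × List V), IsPathSystem Φ Z T ∧ T.card < S.card := by
  obtain ⟨⟨i₁, l⟩, ⟨i₂, m⟩, R, rfl, h1, h2⟩ := exists_cons_cons_of_two_le_card_filter hi
  simp only at h1 h2
  subst h1; subst h2
  obtain ⟨a₀, a, P, rfl⟩ := exists_eq_cons_append_singleton (h.two_le (i₂, l) (by simp))
  obtain ⟨b, c, Q, rfl⟩ := exists_eq_cons_append_singleton (h.two_le (i₂, m) (by simp))
  have hndP := h.nodup (x := (i₂, a₀ :: (P ++ [a]))) (by simp)
  have hndQ := h.nodup (x := (i₂, b :: (Q ++ [c]))) (by simp)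
  simp only at hndP hndQ
  have hb0 : ∀ v, boundary (((i₂, a₀ :: (P ++ [a])) ::ₘ (i₂, b :: (Q ++ [c])) ::ₘ R).map
      fun x => pathParity x.2).sum v = 0 := fun v => by rw [h.sum_eq, hΦ]
  have hb0' : ∀ v, boundary (((i₂, b :: (Q ++ [c])) ::ₘ (i₂, a₀ :: (P ++ [a])) ::ₘ R).map
      fun x => pathParity x.2).sum v = 0 := fun v => by rw [Multiset.cons_swap]; exact hb0 v
  have hac : a ∉ b :: (Q ++ [c]) := fun hmem =>
    h.fst_ne (x := (i₂, b :: (Q ++ [c]))) (by simp) (v := a) (by simp) hmem rfl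
  have hbc : b ≠ c := by rintro rfl; simp at hndQ
  have hbP : b ∉ a₀ :: (P ++ [a]) := fun hmem =>
    h.fst_ne (x := (i₂, b :: (Q ++ [c]))) (by simp) (v := b) hmem (by simp) rfl
  have hcP : c ∉ a₀ :: (P ++ [a]) := fun hmem =>
    h.fst_ne (x := (i₂, b :: (Q ++ [c]))) (by simp) (v := c) hmem (by simp) rfl
  have hswap := h
  rw [Multiset.cons_swap] at hswap
  have partner : ∀ v, (v ∈ a₀ :: (P ++ [a]) ∨ v ∈ b :: (Q ++ [c])) →
      (∃ x ∈ R, boundary (pathParity x.2) v ≠ 0) →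
      ∃ (j : ι) (l t : List V), (j, l) ∈ R ∧ i₂ ≠ j ∧ (l = t ++ [v] ∨ l.reverse = t ++ [v]) := by
    rintro v hv ⟨⟨j, l⟩, hx, hxv⟩
    have hnd := h.nodup (x := (j, l)) (by simp [hx])
    obtain ⟨t, ht⟩ := exists_append_of_boundary_ne_zero hnd hxv
    have hmem := mem_of_boundary_ne_zero hnd hxv
    refine ⟨j, l, t, hx, ?_, ht⟩
    rcases hv with hv | hv
    · exact h.fst_ne (x := (j, l)) (by simp [hx]) hv hmem
    · exact hswap.fst_ne (x := (j, l)) (by simp [hx]) hv hmem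
  have pa := partner a (.inl (by simp)) (by
    obtain ⟨x, hx, hx'⟩ := exists_boundary_ne_zero (hb0 a)
      (boundary_pathParity_eq_one (l := a₀ :: P) hndP (by simp))
    rcases Multiset.mem_cons.1 hx with rfl | hx
    · exact absurd (mem_of_boundary_ne_zero hndQ hx') hac
    · exact ⟨x, hx, hx'⟩)
  have pc := partner c (.inr (by simp)) (by
    obtain ⟨x, hx, hx'⟩ := exists_boundary_ne_zero (hb0' c)
      (boundary_pathParity_eq_one (l := b :: Q) hndQ (by simp))
    rcases Multiset.mem_cons.1 hx with rfl | hx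
    · exact absurd (mem_of_boundary_ne_zero hndP hx') hcP
    · exact ⟨x, hx, hx'⟩)
  have pb := partner b (.inr (by simp)) (by
    have hrev : (b :: (Q ++ [c])).reverse = (c :: Q.reverse) ++ [b] := by simp
    have h1 : boundary (pathParity (b :: (Q ++ [c]))) b = 1 := by
      rw [← pathParity_reverse, hrev]
      refine boundary_pathParity_eq_one ?_ (by simp)
      rw [← hrev]
      exact List.nodup_reverse.2 hndQ
    obtain ⟨x, hx, hx'⟩ := exists_boundary_ne_zero (hb0' b) h1
    rcases Multiset.mem_cons.1 hx with rfl | hx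
    · exact absurd (mem_of_boundary_ne_zero hndP hx') hbP
    · exact ⟨x, hx, hx'⟩)
  obtain ⟨ja, la, ta, hla, hja, hta⟩ := pa
  obtain ⟨jb, lb, tb, hlb, hjb, htb⟩ := pb
  obtain ⟨jc, lc, tc, hlc, hjc, htc⟩ := pc
  have hab : a ≠ b := by rintro rfl; simp at hac
  have hac' : a ≠ c := by rintro rfl; simp at hac
  obtain ⟨R, rfl⟩ := Multiset.exists_cons_of_mem hla
  by_cases h1 : (jb, lb) = (ja, la)
  · by_cases h2 : (jc, lc) = (ja, la)
    -- One path would have the three distinct ends `a`, `b` and `c`.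
    · exfalso
      simp only [Prod.mk.injEq] at h1 h2
      obtain ⟨rfl, rfl⟩ := h1
      obtain ⟨-, rfl⟩ := h2
      have e : ∀ {t : List V} {v : V}, (lc = t ++ [v] ∨ lc.reverse = t ++ [v]) →
          lc.getLast? = some v ∨ lc.head? = some v := by
        rintro t v (h | h)
        · left; simp [h]
        · right; rw [← List.getLast?_reverse, h]; simp
      have ea := e hta
      have eb := e htb
      have ec := e htc
      grind
    · have hmem : (jc, lc) ∈ R := (Multiset.mem_cons.1 hlc).resolve_left h2
      obtain ⟨R, rfl⟩ := Multiset.exists_cons_of_mem hmem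
      -- The second path is reversed, so that it is joined at `c` instead of `b`.
      rw [Multiset.cons_swap] at h
      have h' := h.reverse
      rw [Multiset.cons_swap] at h'
      have hrev : (b :: (Q ++ [c])).reverse = c :: (Q.reverse ++ [b]) := by simp
      rw [hrev] at h'
      obtain ⟨T, hT, hTc⟩ := IsPathSystem.exists_join (P := a₀ :: P) hja hjc hz hta htc h'
      exact ⟨T, hT, by simp only [Multiset.card_cons]; lia⟩
  · have hmem : (jb, lb) ∈ R := (Multiset.mem_cons.1 hlb).resolve_left h1
    obtain ⟨R, rfl⟩ := Multiset.exists_cons_of_mem hmem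
    obtain ⟨T, hT, hTc⟩ := IsPathSystem.exists_join (P := a₀ :: P) hja hjb hz hta htb h
    exact ⟨T, hT, by simp only [Multiset.card_cons]; lia⟩

open scoped Classical in
/-- With enough fresh vertices, all paths of the same colour can be joined into one. -/
theorem IsPathSystem.exists_merged [Fintype V] {Φ : Sym2 V → ZMod 2} (hΦ : ∀ v, boundary Φ v = 0)
    {Z : List V} (hZ : Z.Nodup) {S : Multiset (ι × List V)} (h : IsPathSystem Φ Z S)
    (hcard : S.card < Z.length) :
    ∃ (T : Multiset (ι × List V)) (z : V), IsPathSystem Φ [z] T ∧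
      ∀ i, (T.filter fun x => x.1 = i).card ≤ 1 := by
  induction Z generalizing S with
  | nil => simp at hcard
  | cons z Z ih =>
    by_cases hone : ∀ i, (S.filter fun x => x.1 = i).card ≤ 1
    · refine ⟨S, z, ⟨h.two_le, h.occ_le, h.sum_eq, fun z' hz' => h.fresh z' ?_⟩, hone⟩
      simp only [List.mem_singleton] at hz'
      simp [hz']
    push Not at hone
    obtain ⟨i, hi⟩ := hone
    obtain ⟨T, hT, hTS⟩ := h.exists_smaller hΦ (List.nodup_cons.1 hZ).1 hi
    -- A join spends one fresh vertex and lowers the number of paths, so one vertex is always left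
    -- over.
    exact ih hZ.of_cons hT (by simp only [List.length_cons] at hcard; lia)

theorem cycleParity_append_singleton_of_notMem {l : List V} {z : V} {e : Sym2 V} (he : z ∉ e) :
    cycleParity (l ++ [z]) e = pathParity l e := by
  cases l with
  | nil =>
    have : e ≠ s(z, z) := by rintro rfl; simp at he
    simp [cycleParity, pairParity, this]
  | cons a l =>
    have h0 : ∀ y, pairParity y z e = 0 := by
      intro y
      have : e ≠ s(y, z) := by rintro rfl; simp at he
      simp only [pairParity, if_neg this]
    rw [List.cons_append, cycleParity_cons_append_singleton]
    obtain ⟨l', y, hl'⟩ : ∃ l' y, a :: l = l' ++ [y] :=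
      ⟨_, _, (List.dropLast_append_getLast (List.cons_ne_nil a l)).symm⟩
    have := pathParity_append_cons_cons l' y z []
    rw [← List.cons_append, hl']
    simp only [List.append_assoc, List.cons_append, List.nil_append, this]
    simp [h0, pairParity_comm z a]

/-- The closing vertex is adjacent precisely to the ends of the path, which the boundary detects. -/
theorem cycleParity_append_singleton_mk [Fintype V] {l : List V} {v z : V} (hne : l ≠ [])
    (hl : l.Nodup) (hz : z ∉ l) :
    cycleParity (l ++ [z]) s(v, z) = boundary (pathParity l) v := by
  classical
  obtain ⟨a, l, rfl⟩ := List.exists_cons_of_ne_nil hne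
  rw [boundary_pathParity hl, List.cons_append, cycleParity_cons_append_singleton]
  obtain ⟨l', y, hl'⟩ : ∃ l' y, a :: l = l' ++ [y] :=
    ⟨_, _, (List.dropLast_append_getLast (List.cons_ne_nil a l)).symm⟩
  have h1 := pathParity_append_cons_cons l' y z []
  have h2 : pathParity (l' ++ [y]) s(v, z) = 0 := by
    by_contra h
    rw [hl'] at hz
    exact hz (mem_of_pathParity_ne_zero h (Sym2.mem_mk_right v z))
  have h3 : ∀ u ∈ a :: l, pairParity u z s(v, z) = if v = u then 1 else 0 := by
    intro u hu
    have : z ≠ u := by rintro rfl; exact hz hu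
    by_cases h : v = u <;> simp [pairParity, h, this]
  rw [← List.cons_append, pairParity_comm z a]
  simp only [Pi.add_apply, h3 a (by simp)]
  simp only [hl', List.append_assoc, List.cons_append, List.nil_append, h1, Pi.add_apply, h2,
    h3 y (by simp [hl']), List.getLast_append_singleton]
  simp [add_comm]

theorem IsPathSystem.notMem {Φ : Sym2 V → ZMod 2} {Z : List V} {S : Multiset (ι × List V)}
    (h : IsPathSystem Φ Z S) {z : V} (hz : z ∈ Z) {x : ι × List V} (hx : x ∈ S) : z ∉ x.2 := by
  classical
  obtain ⟨R, rfl⟩ := Multiset.exists_cons_of_mem hx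
  have := h.fresh z hz x.1
  rw [occ_cons, if_pos rfl] at this
  intro hzx
  have h2 := List.count_pos_iff.2 hzx
  lia

/-- Away from `z` nothing changes. At a pair `vz` the closing edges add up to the boundary of `Φ` at
`v`, which is zero, as is `Φ` there because no path meets `z`. -/
theorem IsPathSystem.sum_cycleParity [Fintype V] {Φ : Sym2 V → ZMod 2}
    (hΦ : ∀ v, boundary Φ v = 0) {z : V} {S : Multiset (ι × List V)} (h : IsPathSystem Φ [z] S) :
    (S.map fun x => cycleParity (x.2 ++ [z])).sum = Φ := by
  funext e
  rw [sum_fun_apply]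
  by_cases he : z ∈ e
  · obtain ⟨v, rfl⟩ := Sym2.mem_iff_exists.1 he
    rw [Sym2.eq_swap]
    have h1 : ∀ x ∈ S, cycleParity (x.2 ++ [z]) s(v, z) = boundary (pathParity x.2) v := by
      intro x hx
      have := h.two_le x hx
      refine cycleParity_append_singleton_mk ?_ (h.nodup hx) (h.notMem (by simp) hx)
      rintro h0
      simp [h0] at this
    have h2 : ∀ x ∈ S, pathParity x.2 s(v, z) = 0 := by
      intro x hx
      by_contra hne
      exact h.notMem (by simp) hx (mem_of_pathParity_ne_zero hne (Sym2.mem_mk_right v z))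
    rw [Multiset.map_congr rfl h1, ← boundary_sum, h.sum_eq, hΦ, ← h.sum_eq, sum_fun_apply,
      Multiset.map_congr rfl h2]
    simp
  · simp only [cycleParity_append_singleton_of_notMem he]
    rw [← h.sum_eq, sum_fun_apply]

/-- Once each colour has at most one path, all paths are closed through the same unused vertex. A
path has at least two vertices, so the cycles have length at least 3. -/
theorem c2_le_of_isPathSystem {V : Type u} [Fintype V] {k : ℕ} (G : SimpleGraph V)
    (hG : ∀ v, boundary (edgeParity G) v = 0) {Z : List V} (hZ : Z.Nodup)
    {S : Multiset (Fin k × List V)} (h : IsPathSystem (edgeParity G) Z S)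
    (hcard : S.card < Z.length) : c2 G ≤ k := by
  classical
  obtain ⟨T, z, hT, hT1⟩ := h.exists_merged hG hZ hcard
  refine c2_le_of_card_filter_le G (T.map fun x => (x.1, x.2 ++ [z])) (fun x hx => ?_)
    (fun i v => ?_) ?_ fun i => ?_
  · obtain ⟨y, hy, rfl⟩ := Multiset.mem_map.1 hx
    have := hT.two_le y hy
    simp; lia
  · have h1 : occ (T.map fun x => (x.1, x.2 ++ [z])) i v =
        occ T i v + if v = z then (T.filter fun x => x.1 = i).card else 0 := by
      clear hT hT1
      induction T using Multiset.induction_on with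
      | empty => simp [occ]
      | cons x T ih =>
        rw [Multiset.map_cons, occ_cons, occ_cons, ih]
        by_cases hx : x.1 = i <;> by_cases hv : v = z <;>
          simp [hx, hv, List.count_append, List.count_cons]
        · lia
        · exact Ne.symm hv
    rw [h1]
    by_cases hv : v = z
    · subst hv
      rw [hT.fresh v (by simp), if_pos rfl, zero_add]
      convert hT1 i
    · simpa [hv] using hT.occ_le i v
  · rw [Multiset.map_map]
    exact hT.sum_cycleParity hG
  · rw [Multiset.filter_map, Multiset.card_map]
    convert hT1 i
    rfl

end PathSystem

/-! ### From linear forests to path systems -/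

section LinearForest

open scoped Classical in
theorem pathParity_support {V : Type*} {G : SimpleGraph V} {u v : V} (p : G.Walk u v)
    (e : Sym2 V) : pathParity p.support e = (p.edges.count e : ZMod 2) := by
  induction p with
  | nil => simp
  | @cons u w v h p ih =>
    rw [Walk.support_cons, ← Walk.cons_tail_support, pathParity_cons_cons, Walk.cons_tail_support,
      Pi.add_apply, ih, Walk.edges_cons, List.count_cons, pairParity]
    by_cases he : e = s(u, w)
    · simp [he, add_comm]
    · simp [he, Ne.symm he]

open scoped Classical in
theorem IsLinearForest.exists_lists {V : Type u} [Finite V] {F : SimpleGraph V}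
    (hF : IsLinearForest F) : ∃ L : Multiset (List V), (∀ l ∈ L, 2 ≤ l.length) ∧
      (∀ v, (L.map (List.count v)).sum ≤ 1) ∧ (L.map pathParity).sum = edgeParity F := by
  have := Fintype.ofFinite F.ConnectedComponent
  choose x y p hp hc using hF
  have hsupp : ∀ c v, v ∈ (p c).support ↔ c = F.connectedComponentMk v := by
    intro c v
    rw [← Walk.mem_verts_toSubgraph, ← hc]
    exact eq_comm
  have hedge : ∀ c a b, s(a, b) ∈ (p c).edges ↔ c = F.connectedComponentMk a ∧ F.Adj a b := by
    intro c a b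
    rw [← Walk.adj_toSubgraph_iff_mem_edges, ← hc]
    simp only [Subgraph.induce_adj, Subgraph.top_adj, ConnectedComponent.mem_supp_iff]
    constructor
    · rintro ⟨rfl, -, h⟩
      exact ⟨rfl, h⟩
    · rintro ⟨rfl, h⟩
      exact ⟨rfl, (ConnectedComponent.connectedComponentMk_eq_of_adj h).symm, h⟩
  -- Single-vertex components carry no edge and are dropped.
  let A : Finset F.ConnectedComponent := {c | 2 ≤ (p c).support.length}
  refine ⟨A.val.map fun c => (p c).support, ?_, fun v => ?_, ?_⟩
  · intro l hl
    obtain ⟨c, hc, rfl⟩ := Multiset.mem_map.1 hl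
    exact (Finset.mem_filter.1 hc).2
  · rw [Multiset.map_map]
    change ∑ c ∈ A, (p c).support.count v ≤ 1
    calc ∑ c ∈ A, (p c).support.count v ≤ ∑ c, (p c).support.count v :=
          Finset.sum_le_sum_of_subset (Finset.subset_univ A)
      _ = ∑ c, if c = F.connectedComponentMk v then 1 else 0 := by
          refine Finset.sum_congr rfl fun c _ => ?_
          rw [(hp c).support_nodup.count]
          exact if_congr (hsupp c v) rfl rfl
      _ ≤ 1 := by simp
  · rw [Multiset.map_map]
    change ∑ c ∈ A, pathParity (p c).support = edgeParity F
    have h0 : ∑ c ∈ A, pathParity (p c).support = ∑ c, pathParity (p c).support := by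
      refine Finset.sum_subset (Finset.subset_univ A) fun c _ hcA => ?_
      have : ¬ 2 ≤ (p c).support.length := fun h => hcA (Finset.mem_filter.2 ⟨Finset.mem_univ c, h⟩)
      match hl : (p c).support, this with
      | [], _ => rfl
      | [_], _ => rfl
      | _ :: _ :: _, h => simp at h
    rw [h0]
    funext e
    induction e using Sym2.ind with
    | _ a b =>
    rw [Finset.sum_apply]
    have h1 : ∀ c, pathParity (p c).support s(a, b) =
        if c = F.connectedComponentMk a then edgeParity F s(a, b) else 0 := by
      intro c
      rw [pathParity_support, (hp c).isTrail.edges_nodup.count]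
      by_cases h1 : c = F.connectedComponentMk a <;> by_cases h2 : F.Adj a b <;>
        simp [hedge, h1, h2, edgeParity]
    simp [h1]

theorem IsLinearForestDecomposition.exists_isPathSystem {V : Type u} [Finite V]
    {G : SimpleGraph V} {k : ℕ} {F : Fin k → SimpleGraph V} (h : IsLinearForestDecomposition G F) :
    ∃ S : Multiset (Fin k × List V), IsPathSystem (edgeParity G) [] S := by
  classical
  obtain ⟨hF, hdisj, hunion⟩ := h
  choose L hL2 hLc hLs using fun i => (hF i).exists_lists
  refine ⟨∑ i, (L i).map (Prod.mk i), ?_, fun i v => ?_, ?_, by simp⟩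
  · intro x hx
    obtain ⟨i, -, hx⟩ := Multiset.mem_sum.1 hx
    obtain ⟨l, hl, rfl⟩ := Multiset.mem_map.1 hx
    exact hL2 i l hl
  · rw [occ, sum_map_sum_map_mk, Finset.sum_eq_single i]
    · simpa only [if_true] using hLc i v
    · intro j _ hj
      simp [hj]
    · simp
  · rw [sum_map_sum_map_mk]
    have : ∀ i, ((L i).map fun l => pathParity l).sum = edgeParity (F i) := hLs
    simp only [this]
    funext e
    rw [Finset.sum_apply]
    by_cases he : e ∈ G.edgeSet
    · rw [edgeParity_of_mem he]
      rw [hunion] at he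
      obtain ⟨i, hi⟩ := Set.mem_iUnion.1 he
      rw [Finset.sum_eq_single i, edgeParity_of_mem hi]
      · intro j _ hj
        exact edgeParity_of_notMem fun hj' => Set.disjoint_left.1 (hdisj j i hj) hj' hi
      · simp
    · rw [edgeParity_of_notMem he]
      refine Finset.sum_eq_zero fun i _ => edgeParity_of_notMem fun hi => he ?_
      rw [hunion]
      exact Set.mem_iUnion.2 ⟨i, hi⟩

theorem edgeParity_sum_bot {V W : Type*} (G : SimpleGraph V) (e : Sym2 V) :
    edgeParity (G ⊕g (⊥ : SimpleGraph W)) (e.map Sum.inl) = edgeParity G e := by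
  have : e.map Sum.inl ∈ (G ⊕g (⊥ : SimpleGraph W)).edgeSet ↔ e ∈ G.edgeSet := by
    induction e using Sym2.ind with
    | _ a b => simp
  by_cases h : e ∈ G.edgeSet
  · rw [edgeParity_of_mem h, edgeParity_of_mem (this.2 h)]
  · rw [edgeParity_of_notMem h, edgeParity_of_notMem (mt this.1 h)]

theorem edgeParity_sum_bot_inr {V W : Type*} (G : SimpleGraph V) (w : W) (x : V ⊕ W) :
    edgeParity (G ⊕g (⊥ : SimpleGraph W)) s(Sum.inr w, x) = 0 := by
  refine edgeParity_of_notMem ?_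
  rw [mem_edgeSet]
  cases x <;> simp

/-- Here the even degrees enter the bound by linear arboricity. -/
theorem boundary_edgeParity {V : Type*} [Fintype V] {G : SimpleGraph V} [DecidableRel G.Adj]
    (hG : ∀ v, Even (G.degree v)) (v : V) : boundary (edgeParity G) v = 0 := by
  have h : boundary (edgeParity G) v = (G.degree v : ZMod 2) := by
    rw [← G.card_neighborFinset_eq_degree, neighborFinset_eq_filter, Finset.card_filter,
      Nat.cast_sum, boundary]
    refine Finset.sum_congr rfl fun w _ => ?_
    by_cases h : G.Adj v w <;> simp [edgeParity, h]
  rw [h, ZMod.natCast_eq_zero_iff_even]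
  exact hG v

theorem boundary_edgeParity_sum_bot {V W : Type*} [Fintype V] [Fintype W] {G : SimpleGraph V}
    (hG : ∀ v, boundary (edgeParity G) v = 0) (x : V ⊕ W) :
    boundary (edgeParity (G ⊕g (⊥ : SimpleGraph W))) x = 0 := by
  rw [boundary, Fintype.sum_sum_type]
  cases x with
  | inl v =>
    have h1 : ∀ w, edgeParity (G ⊕g (⊥ : SimpleGraph W)) s(Sum.inl v, Sum.inl w) =
        edgeParity G s(v, w) := fun w => edgeParity_sum_bot G s(v, w)
    have h2 : ∀ w, edgeParity (G ⊕g (⊥ : SimpleGraph W)) s(Sum.inl v, Sum.inr w) = 0 := fun w => by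
      rw [Sym2.eq_swap]; exact edgeParity_sum_bot_inr G w _
    simp only [h1, h2, Finset.sum_const_zero, add_zero]
    exact hG v
  | inr w => simp [edgeParity_sum_bot_inr]

theorem pathParity_map_inl_inr {V W : Type*} (l : List V) (w : W) (x : V ⊕ W) :
    pathParity (l.map Sum.inl) s(Sum.inr w, x) = 0 := by
  by_contra h
  have := mem_of_pathParity_ne_zero h (Sym2.mem_mk_left _ x)
  simp at this

theorem count_map_apply {V W : Type*} {_ : DecidableEq V} {_ : DecidableEq W} {f : V → W}
    (hf : Function.Injective f) (l : List V) (v : V) : (l.map f).count (f v) = l.count v :=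
  List.count_map_of_injective _ _ hf v

theorem IsPathSystem.map_inl {V W ι : Type*} {G : SimpleGraph V} {S : Multiset (ι × List V)}
    (h : IsPathSystem (edgeParity G) [] S) (Z : List W) :
    IsPathSystem (edgeParity (G ⊕g (⊥ : SimpleGraph W))) (Z.map Sum.inr)
      (S.map fun x => (x.1, x.2.map (Sum.inl : V → V ⊕ W))) := by
  classical
  have hinj : Function.Injective (Sum.inl : V → V ⊕ W) := Sum.inl_injective
  have hsum : ∀ e, (S.map fun x => pathParity x.2 e).sum = edgeParity G e := fun e => by
    rw [← h.sum_eq, sum_fun_apply]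
  obtain ⟨h2, hocc, -, -⟩ := h
  have hinl : ∀ i v, occ (S.map fun x => (x.1, x.2.map (Sum.inl : V → V ⊕ W))) i (Sum.inl v) =
      occ S i v := by
    intro i v
    rw [occ, occ, Multiset.map_map]
    congr 1
    refine Multiset.map_congr rfl fun x _ => ?_
    simp only [Function.comp]
    congr 1
    exact count_map_apply hinj _ _
  have hinr : ∀ i w, occ (S.map fun x => (x.1, x.2.map (Sum.inl : V → V ⊕ W))) i (Sum.inr w) =
      0 := by
    intro i w
    rw [occ, Multiset.map_map, Multiset.sum_eq_zero_iff]
    intro n hn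
    obtain ⟨x, -, rfl⟩ := Multiset.mem_map.1 hn
    simp [List.count_eq_zero]
  refine ⟨fun x hx => ?_, fun i v => ?_, ?_, fun z hz i => ?_⟩
  · obtain ⟨y, hy, rfl⟩ := Multiset.mem_map.1 hx
    simpa using h2 y hy
  · cases v with
    | inl v => rw [hinl]; exact hocc i v
    | inr w => rw [hinr]; exact zero_le_one
  · funext e
    rw [sum_fun_apply, Multiset.map_map]
    simp only [Function.comp]
    induction e using Sym2.ind with
    | _ a b =>
    have hzero : ∀ (w : W) (x : V ⊕ W),
        (S.map fun y => pathParity (y.2.map Sum.inl) s(Sum.inr w, x)).sum =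
          edgeParity (G ⊕g (⊥ : SimpleGraph W)) s(Sum.inr w, x) := by
      intro w x
      simp [pathParity_map_inl_inr, edgeParity_sum_bot_inr]
    cases a with
    | inr w => exact hzero w b
    | inl a =>
      cases b with
      | inr w => rw [Sym2.eq_swap]; exact hzero w _
      | inl b =>
        have h1 : s(Sum.inl a, Sum.inl b) = Sym2.map (Sum.inl : V → V ⊕ W) s(a, b) := rfl
        simp only [h1, pathParity_map hinj, edgeParity_sum_bot]
        exact hsum _
  · obtain ⟨w, -, rfl⟩ := List.mem_map.1 hz
    exact hinr i w

theorem c2Iso_le_la {V : Type u} [Fintype V] (G : SimpleGraph V) [DecidableRel G.Adj]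
    (hG : ∀ v, Even (G.degree v)) : c2Iso G ≤ la G := by
  refine le_sInf ?_
  rintro _ ⟨k, F, hF, rfl⟩
  obtain ⟨S, hS⟩ := hF.exists_isPathSystem
  -- There are fewer joins than paths, and one further vertex closes the cycles; `S.card + 1` is
  -- ample.
  refine (iInf_le _ (S.card + 1)).trans ?_
  refine c2_le_of_isPathSystem _ (boundary_edgeParity_sum_bot (boundary_edgeParity hG))
    (Z := (List.finRange (S.card + 1)).map Sum.inr) ?_ (hS.map_inl _) (by simp)
  exact (List.nodup_finRange _).map Sum.inr_injective

end LinearForest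

end OddCover

/-- The existence of a cycle odd-cover is contained in the last bound, since `c2` would be `⊤`
otherwise. The first equation is doubled to avoid division in `ℕ∞`. -/
theorem mainTheorem4 {V : Type*} [Fintype V] (G : SimpleGraph V) [DecidableRel G.Adj]
    (hG : ∀ v : V, Even (G.degree v)) :
    (¬ OddCover.IsUnionOfTwoOrMoreDisjointCycles G →
      2 * OddCover.c2Top G = (G.maxDegree : ℕ∞)) ∧
    OddCover.c2Iso G ≤ OddCover.la G ∧
    OddCover.c2 G ≤ (G.maxDegree : ℕ∞) := by
  obtain ⟨k, hk⟩ := OddCover.exists_maxDegree_eq_two_mul G hG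
  exact ⟨OddCover.two_mul_c2Top_eq G hG hk, OddCover.c2Iso_le_la G hG,
    OddCover.c2_le_maxDegree G hG hk⟩
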